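/- Let $d\in\{2,3\}$, let $\Omega\subset\mathbb R^d$ be a nonempty bounded open convex set, and let $\mathcal T_h$ be a finite conforming mesh of $\overline\Omega$ (all cells triangles or all cells rectangles if $d=2$, all cells tetrahedra if $d=3$). Let $$V_h=\Big\{v\in L^2(\Omega):\ v|_S\in\mathbb P_1\ \text{for all cells } S\in\mathcal T_h,\ \int_E[\![v]\!]=0\ \text{for all facets } E\Big\}$$ be the Crouzeix–Raviart space, where $[\![v]\!]$ is the jump across an interior facet and the trace of $v$ on a boundary facet. Let $\nabla_h$ be the cellwise gradient, $(\cdot,\cdot)$ the $L^2(\Omega)$ inner product, and $(\cdot,\cdot)_{\mathcal T_h}$ the sum of the $L^2$ inner products over the cells. Let $\nu,\alpha,\beta>0$, $\gamma\in(0,1)$, $\delta\in[1,\infty)$, $\eta\ge 0$, $T>0$. Powers $s^\delta$ of negative reals $s$ are understood as $s^\delta=\kappa|s|^\delta$, where $\kappa\in\mathbb R$ is an arbitrary fixed number ($\kappa=(-1)^\delta$ gives the usual power if $\delta$ is an integer; $\kappa=1$ gives $|s|^\delta$). Let $K\in L^1(0,T)$ be a positive kernel, i.e. $\int_0^S\int_0^tK(t-\tau)\varphi(\tau)\varphi(t)\,d\tau\,dt\ge0$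 for all $S\in(0,T]$ and $\varphi\in L^2(0,S)$. Put $c(u)=u(1-u^\delta)(u^\delta-\gamma)$, $$b_{CR}(u;u,w)=\frac1{\delta+2}\Big(u^\delta\sum_{i=1}^d\frac{\partial u}{\partial x_i},w\Big)_{\mathcal T_h}-\frac1{\delta+2}\Big(u^\delta\sum_{i=1}^d\frac{\partial w}{\partial x_i},u\Big)_{\mathcal T_h},$$ $$A_{CR}(u,w)=\nu(\nabla_hu,\nabla_hw)+\alpha\, b_{CR}(u;u,w)-\beta(c(u),w).$$ Let $f\in L^2(0,T;L^2(\Omega))$ and let $u_h^0\in L^2(\Omega)$ be an initial datum (for example $u_0$ itself, or an approximation of $u_0$ in $V_h$). A solution of the semi-discrete scheme on $[0,T]$ is an absolutely continuous $u_h:[0,T]\to V_h$ such that $(u_h(0),\chi)=(u_h^0,\chi)$ for all $\chi\in V_h$ and, for almost every $t\in(0,T)$, $u_h$ is differentiable at $t$ and $$(\partial_tu_h(t),\chi)+A_{CR}(u_h(t),\chi)+\eta\Big(\int_0^tK(t-\tau)\nabla_hu_h(\tau)\,d\tau,\nabla_h\chi\Big)=(f(t),\chi)\qquad\text{for all }\chi\in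 V_h .$$ Then the scheme has at least one solution on $[0,T]$. Moreover, if $u_h^0\in L^{d\delta}(\Omega)$, the solution on $[0,T]$ is unique. -/

import Mathlib

open MeasureTheory Set

noncomputable section

namespace CRScheme

/-- Points of `ℝ^d` with the Euclidean norm. -/
abbrev Pt (d : ℕ) := EuclideanSpace ℝ (Fin d)

/-- The space `L²(Ω)` (classes of functions modulo a.e. equality). -/
abbrev L2 {d : ℕ} (Ω : Set (Pt d)) := Lp ℝ 2 (volume.restrict Ω)

/-- The polynomials of degree at most one on `ℝ^d`. -/
abbrev P1 (d : ℕ) := Pt d →ᵃ[ℝ] ℝ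

/-- `T` is the vertex set of a nondegenerate simplex (a triangle if `d = 2`, a tetrahedron if
`d = 3`). -/
def IsSimplexCell {d : ℕ} (T : Finset (Pt d)) : Prop :=
  T.card = d + 1 ∧ AffineIndependent ℝ ((↑) : T → Pt d)

/-- `T` is the vertex set of a nondegenerate rectangle. -/
def IsRectangleCell {d : ℕ} (T : Finset (Pt d)) : Prop :=
  ∃ p a b : Pt d, a ≠ 0 ∧ b ≠ 0 ∧ inner ℝ a b = 0 ∧
    (T : Set (Pt d)) = {p, p + a, p + b, p + a + b}

/-- The closed cell with vertex set `T`. -/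
def cell {d : ℕ} (T : Finset (Pt d)) : Set (Pt d) := convexHull ℝ (T : Set (Pt d))

/-- A finite conforming mesh of `Ω`: all cells are simplices, or, in dimension two, all cells are
rectangles. Cells are given by their vertex sets. Conformity: two cells meet in the convex hull of
their common vertices, that is, not at all or in a common face. -/
structure Mesh (d : ℕ) (Ω : Set (Pt d)) where
  cells : Finset (Finset (Pt d))
  shape : (∀ T ∈ cells, IsSimplexCell T) ∨ (d = 2 ∧ ∀ T ∈ cells, IsRectangleCell T)
  cover : ⋃ T ∈ cells, cell T = closure Ω
  conforming : ∀ T ∈ cells, ∀ T' ∈ cells,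
    cell T ∩ cell T' = convexHull ℝ ((T : Set (Pt d)) ∩ (T' : Set (Pt d)))

/-- `F` is the vertex set of a facet (a face of codimension one: an edge if `d = 2`, a triangular
face if `d = 3`) of the cell with vertex set `T`. -/
def IsFacet {d : ℕ} (F T : Finset (Pt d)) : Prop :=
  F ⊆ T ∧ IsExposed ℝ (cell T) (cell F) ∧
    Module.finrank ℝ (vectorSpan ℝ (F : Set (Pt d))) + 1 = d

/-- The integral of `g` over the facet with vertex set `F`, for the surface measure. -/
def facetIntegral {d : ℕ} (F : Finset (Pt d)) (g : Pt d → ℝ) : ℝ :=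
  ∫ x in cell F, g x ∂(Measure.euclideanHausdorffMeasure (d - 1))

lemma surface_cell_lt_top {d : ℕ} (F : Finset (Pt d))
    (hF : Module.finrank ℝ (vectorSpan ℝ (F : Set (Pt d))) + 1 = d) :
    (Measure.euclideanHausdorffMeasure (d - 1) : Measure (Pt d)) (cell F) ≠ ⊤ := by
  set V := vectorSpan ℝ (F : Set (Pt d)) with hV
  have hn : Module.finrank ℝ V = d - 1 := by omega
  rcases F.eq_empty_or_nonempty with rfl | ⟨p, hp⟩
  · simp [cell]
  have hsub : cell F ⊆ (fun v : V => (v : Pt d) + p) '' Metric.closedBall 0 (Metric.diam (cell F)) := by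
    intro x hx
    have hb : Bornology.IsBounded (cell F) := F.finite_toSet.isCompact_convexHull (𝕜 := ℝ).isBounded
    have hpc : p ∈ cell F := subset_convexHull ℝ _ hp
    have h1 : x ∈ affineSpan ℝ (F : Set (Pt d)) := convexHull_subset_affineSpan (𝕜 := ℝ) _ hx
    have h2 : x - p ∈ V := by
      rw [hV, ← direction_affineSpan]
      exact AffineSubspace.vsub_mem_direction h1 (mem_affineSpan ℝ hp)
    refine ⟨⟨x - p, h2⟩, ?_, by simp⟩
    rw [mem_closedBall_zero_iff]
    change ‖x - p‖ ≤ _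
    rw [← dist_eq_norm]
    exact Metric.dist_le_diam_of_mem hb hx hpc
  have hiso : Isometry (fun v : V => (v : Pt d) + p) :=
    (IsometryEquiv.addRight p).isometry.comp (Submodule.subtypeₗᵢ V).isometry
  refine ((measure_mono hsub).trans_lt ?_).ne
  rw [hiso.euclideanHausdorffMeasure_image, ← hn]
  exact (isCompact_closedBall _ _).measure_lt_top

lemma integrableOn_facet {d : ℕ} (F : Finset (Pt d))
    (hF : Module.finrank ℝ (vectorSpan ℝ (F : Set (Pt d))) + 1 = d) (p : P1 d) :
    IntegrableOn (fun x => p x) (cell F) (Measure.euclideanHausdorffMeasure (d - 1)) := by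
  have hc : Continuous (fun x => p x) := AffineMap.continuous_of_finiteDimensional p
  have hK : IsCompact (cell F) := F.finite_toSet.isCompact_convexHull (𝕜 := ℝ)
  obtain ⟨C, hC⟩ := hK.exists_bound_of_continuousOn hc.continuousOn
  refine Measure.integrableOn_of_bounded (M := C) (surface_cell_lt_top F hF)
    hc.aestronglyMeasurable ?_
  exact (ae_restrict_iff' hK.measurableSet).2 (Filter.Eventually.of_forall hC)

namespace Mesh

variable {d : ℕ} {Ω : Set (Pt d)} (M : Mesh d Ω)

/-- `v|_T = p T` for every cell `T` of the mesh. -/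
def Represents (p : Finset (Pt d) → P1 d) (v : L2 Ω) : Prop :=
  ∀ T ∈ M.cells, ∀ᵐ x ∂(volume.restrict Ω), x ∈ cell T → v x = p T x

/-- The jump of the piecewise polynomial `p` has zero integral over every facet; on a facet that
belongs to one cell only (a boundary facet) the jump is the trace itself. -/
def MeanJumpZero (p : Finset (Pt d) → P1 d) : Prop :=
  (∀ T ∈ M.cells, ∀ T' ∈ M.cells, T ≠ T' → ∀ F, IsFacet F T → IsFacet F T' →
    facetIntegral F (fun x => p T x - p T' x) = 0) ∧
  (∀ T ∈ M.cells, ∀ F, IsFacet F T → (∀ T' ∈ M.cells, IsFacet F T' → T' = T) →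
    facetIntegral F (fun x => p T x) = 0)

/-- The Crouzeix-Raviart space `V_h`, a subspace of `L²(Ω)`. -/
def crSpace : Submodule ℝ (L2 Ω) where
  carrier := {v | ∃ p : Finset (Pt d) → P1 d, M.Represents p v ∧ M.MeanJumpZero p}
  zero_mem' := by
    refine ⟨0, fun T _ => ?_, fun T _ T' _ _ F _ _ => ?_, fun T _ F _ _ => ?_⟩
    · filter_upwards [Lp.coeFn_zero ℝ 2 (volume.restrict Ω)] with x hx _
      exact hx
    · simp [facetIntegral]
    · simp [facetIntegral]
  add_mem' := by
    rintro v w ⟨p, hp, hp1, hp2⟩ ⟨q, hq, hq1, hq2⟩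
    refine ⟨p + q, fun T hT => ?_, fun T hT T' hT' hne F hF hF' => ?_, fun T hT F hF hu => ?_⟩
    · filter_upwards [Lp.coeFn_add v w, hp T hT, hq T hT] with x hx h1 h2 hxT
      exact hx.trans (congrArg₂ (· + ·) (h1 hxT) (h2 hxT))
    · have h1 := hp1 T hT T' hT' hne F hF hF'
      have h2 := hq1 T hT T' hT' hne F hF hF'
      have e := integral_add (integrableOn_facet F hF.2.2 (p T - p T'))
        (integrableOn_facet F hF.2.2 (q T - q T'))
      simp only [facetIntegral, AffineMap.coe_sub, Pi.sub_apply] at h1 h2 e ⊢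
      rw [h1, h2, add_zero] at e
      rw [← e]
      congr 1
      ext x
      simp only [Pi.add_apply, AffineMap.coe_add]
      ring
    · have h1 := hp2 T hT F hF hu
      have h2 := hq2 T hT F hF hu
      have e := integral_add (integrableOn_facet F hF.2.2 (p T)) (integrableOn_facet F hF.2.2 (q T))
      simp only [facetIntegral] at h1 h2 e ⊢
      rw [h1, h2, add_zero] at e
      rw [← e]
      rfl
  smul_mem' := by
    rintro c v ⟨p, hp, hp1, hp2⟩
    refine ⟨c • p, fun T hT => ?_, fun T hT T' hT' hne F hF hF' => ?_, fun T hT F hF hu => ?_⟩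
    · filter_upwards [Lp.coeFn_smul c v, hp T hT] with x hx h1 hxT
      exact hx.trans (congrArg (c • ·) (h1 hxT))
    · have h1 := hp1 T hT T' hT' hne F hF hF'
      simp only [facetIntegral] at h1 ⊢
      simp only [Pi.smul_apply, AffineMap.coe_smul, ← smul_sub]
      rw [integral_smul, h1, smul_zero]
    · have h1 := hp2 T hT F hF hu
      simp only [facetIntegral] at h1 ⊢
      simp only [Pi.smul_apply, AffineMap.coe_smul]
      rw [integral_smul, h1, smul_zero]

open Classical in
/-- The polynomials `v|_T` of a function `v` that is a polynomial of degree at most one on every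
cell; they are determined by `v`, since `Ω ∩ T` has interior points. -/
def localPoly (v : L2 Ω) : Finset (Pt d) → P1 d :=
  if h : ∃ p, M.Represents p v then h.choose else 0

/-- The partial derivative `∂v/∂x_i` on the cell `T`, a constant. -/
def pderiv (v : L2 Ω) (T : Finset (Pt d)) (i : Fin d) : ℝ :=
  (M.localPoly v T).linear (EuclideanSpace.single i 1)

/-- The value of the piecewise gradient `∇_h v` on the cell `T`. -/
def grad (v : L2 Ω) (T : Finset (Pt d)) : Pt d :=
  WithLp.toLp 2 (fun i => M.pderiv v T i)

/-- `∑_T ∫_T G_T · H_T dx` for vector fields that equal the constants `G T`, `H T` on the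
cells. -/
def gradInner (G H : Finset (Pt d) → Pt d) : ℝ :=
  ∑ T ∈ M.cells, ∫ _x in cell T, inner ℝ (G T) (H T)

/-- `a_CR(u, w) = (∇_h u, ∇_h w)`. -/
def aCR (u w : L2 Ω) : ℝ := M.gradInner (M.grad u) (M.grad w)

end Mesh

/-- The power `s ^ δ` of a real number. For `s < 0` it is `κ |s| ^ δ`, where the number `κ` plays
the role of `(-1) ^ δ`. -/
def rpowκ (κ δ s : ℝ) : ℝ := if 0 ≤ s then s ^ δ else κ * |s| ^ δ

/-- For a natural number `n` and `κ = (-1) ^ n` this is the usual power. -/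
lemma rpowκ_natCast (n : ℕ) (s : ℝ) : rpowκ ((-1) ^ n) n s = s ^ n := by
  unfold rpowκ
  split_ifs with h
  · exact Real.rpow_natCast s n
  · rw [Real.rpow_natCast, abs_of_neg (not_le.1 h), ← mul_pow]
    simp

/-- `c(s) = s (1 - s^δ) (s^δ - γ)`. -/
def cFun (κ δ γ s : ℝ) : ℝ := s * (1 - rpowκ κ δ s) * (rpowκ κ δ s - γ)

namespace Mesh

variable {d : ℕ} {Ω : Set (Pt d)} (M : Mesh d Ω)

/-- The convection form `b_CR(u; u, w) = (δ + 2)⁻¹ (u^δ ∑ᵢ ∂ᵢu, w)_h - (δ + 2)⁻¹ (u^δ ∑ᵢ ∂ᵢw, u)_h`,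
where `(·, ·)_h` is the sum of the integrals over the cells. -/
def bCR (κ δ : ℝ) (u w : L2 Ω) : ℝ :=
  1 / (δ + 2) * (∑ T ∈ M.cells, ∫ x in cell T,
      rpowκ κ δ (M.localPoly u T x) * (∑ i, M.pderiv u T i) * M.localPoly w T x)
    - 1 / (δ + 2) * (∑ T ∈ M.cells, ∫ x in cell T,
      rpowκ κ δ (M.localPoly u T x) * (∑ i, M.pderiv w T i) * M.localPoly u T x)

/-- `A_CR(u, w) = ν a_CR(u, w) + α b_CR(u; u, w) - β (c(u), w)`. -/
def ACR (κ ν α β γ δ : ℝ) (u w : L2 Ω) : ℝ :=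
  ν * M.aCR u w + α * M.bCR κ δ u w - β * ∫ x in Ω, cFun κ δ γ (u x) * w x

/-- The memory field `(K * ∇_h u)(t) = ∫₀ᵗ K(t - τ) ∇_h u(τ) dτ` on the cell `T`. -/
def memory (K : ℝ → ℝ) (u : ℝ → L2 Ω) (t : ℝ) (T : Finset (Pt d)) : Pt d :=
  ∫ τ in (0 : ℝ)..t, K (t - τ) • M.grad (u τ) T

/-- `u` is a solution on `[0, T]` of the semi-discrete scheme with right-hand side `f` and initial
datum `u₀`: an absolutely continuous function of time with values in `V_h` which satisfies the
equation for almost every time. Its values outside `[0, T]` are irrelevant. -/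
structure IsSolution (κ ν α β γ δ η : ℝ) (K : ℝ → ℝ) (T : ℝ) (f : ℝ → L2 Ω) (u₀ : L2 Ω)
    (u : ℝ → L2 Ω) : Prop where
  mem : ∀ t ∈ Icc 0 T, u t ∈ M.crSpace
  ac : AbsolutelyContinuousOnInterval u 0 T
  diff : ∀ᵐ t ∂(volume.restrict (Ioo 0 T)), DifferentiableAt ℝ u t
  eqn : ∀ᵐ t ∂(volume.restrict (Ioo 0 T)), ∀ χ ∈ M.crSpace,
    inner ℝ (deriv u t) χ + M.ACR κ ν α β γ δ (u t) χ
      + η * M.gradInner (M.memory K u t) (M.grad χ) = inner ℝ (f t) χ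
  init : ∀ χ ∈ M.crSpace, inner ℝ (u 0) χ = inner ℝ u₀ χ

end Mesh

/-- `K` is a weakly singular positive kernel on `(0, T)`. -/
def IsPositiveKernel (K : ℝ → ℝ) (T : ℝ) : Prop :=
  IntegrableOn K (Ioo 0 T) ∧
    ∀ S, 0 < S → S ≤ T → ∀ φ : ℝ → ℝ, MemLp φ 2 (volume.restrict (Ioo 0 S)) →
      0 ≤ ∫ t in (0 : ℝ)..S, ∫ τ in (0 : ℝ)..t, K (t - τ) * φ τ * φ t

end CRScheme

end

namespace CRScheme

/-! A function in `V_h` is determined by its finitely many affine pieces, so `V_h` is a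
finite-dimensional Hilbert space and the scheme is an ordinary differential equation with memory,
`u' = P f - A(u) - η ∑ⱼ (K * ⟪eⱼ, u⟫) eⱼ`. Here `P` is the `L²` projection onto `V_h`, `A(u)`
represents the functional `A_CR(u, ·)`, and the `eⱼ` represent the partial derivatives on the cells,
weighted by the square root of the cell volume.

Two properties of `A` matter. It is Lipschitz on balls: for `δ ≥ 1` the nonlinearities are locally
Lipschitz, and the `L²` norm controls the values and gradients of the pieces. It is bounded below,
`⟪A u, u⟫ ≥ -β ‖u‖²`: the diffusion is nonnegative, `b_CR(u; u, u) = 0`, and `(1 - r)(r - γ) ≤ 1`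
for every real `r`.

Existence: precomposing `A` with the retraction onto a ball of radius `R` makes it globally
Lipschitz, and Picard iteration for causal operators solves the truncated equation on all of `[0,
T]` (`IsVolterra.exists_solution`). The energy identity, the positivity of the kernel and Gronwall's
inequality bound this solution independently of `R`; for `R` above the bound the truncation is
inactive (`evolution_exists`). Uniqueness: two solutions are bounded, so both solve one truncated
equation (`evolution_unique`). The scheme and its integral equation are equivalent because an
absolutely continuous function is recovered from its almost everywhere derivative. -/

lemma intervalIntegrable_of_mem_Icc {E : Type*} [NormedAddCommGroup E] {F : ℝ → E} {T t : ℝ}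
    (h : IntervalIntegrable F volume 0 T) (ht : t ∈ Icc 0 T) : IntervalIntegrable F volume 0 t :=
  h.mono_set (by
    rw [uIcc_of_le ht.1, uIcc_of_le (ht.1.trans ht.2)]
    exact Icc_subset_Icc_right ht.2)

/-! ### Picard iteration for causal Lipschitz operators -/

section Volterra

variable {E : Type*} [NormedAddCommGroup E] [NormedSpace ℝ E]

/-- A causal Lipschitz operator, acting on functions that are continuous on `[0, T]`. -/
structure IsVolterra (N : (ℝ → E) → ℝ → E) (T C : ℝ) : Prop where
  nonneg : 0 ≤ C
  int : ∀ u, ContinuousOn u (Icc 0 T) → IntervalIntegrable (N u) volume 0 T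
  lip : ∀ u v, ContinuousOn u (Icc 0 T) → ContinuousOn v (Icc 0 T) → ∀ t ∈ Icc 0 T, ∀ D, 0 ≤ D →
    (∀ s ∈ Icc 0 t, ‖u s - v s‖ ≤ D) → ‖N u t - N v t‖ ≤ C * D

lemma continuousOn_primitive_Icc {F : ℝ → E} {T : ℝ} (hT : 0 ≤ T)
    (h : IntervalIntegrable F volume 0 T) :
    ContinuousOn (fun t => ∫ s in (0 : ℝ)..t, F s) (Icc 0 T) := by
  have := intervalIntegral.continuousOn_primitive_interval' h left_mem_uIcc
  rwa [uIcc_of_le hT] at this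

/-- One Picard step: integrating the causal Lipschitz estimate turns one term of the exponential
series into the next. -/
lemma IsVolterra.norm_integral_sub_le {N : (ℝ → E) → ℝ → E} {T C : ℝ} (hN : IsVolterra N T C)
    {u v : ℝ → E} (hu : ContinuousOn u (Icc 0 T)) (hv : ContinuousOn v (Icc 0 T)) {D : ℝ}
    (hD : 0 ≤ D) (n : ℕ)
    (h : ∀ t ∈ Icc 0 T, ‖u t - v t‖ ≤ D * ((C * t) ^ n / n.factorial)) :
    ∀ t ∈ Icc 0 T, ‖(∫ s in (0 : ℝ)..t, N u s) - ∫ s in (0 : ℝ)..t, N v s‖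
      ≤ D * ((C * t) ^ (n + 1) / (n + 1).factorial) := by
  intro t ht
  have hC := hN.nonneg
  rw [← intervalIntegral.integral_sub (intervalIntegrable_of_mem_Icc (hN.int u hu) ht)
    (intervalIntegrable_of_mem_Icc (hN.int v hv) ht)]
  have key : ‖∫ s in (0 : ℝ)..t, (N u s - N v s)‖
      ≤ ∫ s in (0 : ℝ)..t, (D * C ^ (n + 1) / n.factorial) * s ^ n := by
    refine intervalIntegral.norm_integral_le_of_norm_le ht.1 (Filter.Eventually.of_forall ?_)
      (Continuous.intervalIntegrable (by fun_prop) _ _)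
    intro s hs
    have hs0 : 0 ≤ s := hs.1.le
    -- The bound increases in time, so its value at `s` dominates on `[0, s]`; causality asks for no
    -- more.
    refine (hN.lip u v hu hv s ⟨hs0, hs.2.trans ht.2⟩ (D * ((C * s) ^ n / n.factorial))
      (by positivity) ?_).trans (le_of_eq (by ring))
    intro r hr
    refine (h r ⟨hr.1, hr.2.trans (hs.2.trans ht.2)⟩).trans ?_
    have := hr.1
    have := hr.2
    gcongr
  refine key.trans (le_of_eq ?_)
  rw [intervalIntegral.integral_const_mul, integral_pow, Nat.factorial_succ]
  push_cast
  field_simp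
  simp [mul_pow, mul_assoc]

lemma IsVolterra.eqOn {N : (ℝ → E) → ℝ → E} {T C : ℝ} (hN : IsVolterra N T C) {x₀ : E}
    {u v : ℝ → E} (hu : ContinuousOn u (Icc 0 T)) (hv : ContinuousOn v (Icc 0 T))
    (hu' : ∀ t ∈ Icc 0 T, u t = x₀ + ∫ s in (0 : ℝ)..t, N u s)
    (hv' : ∀ t ∈ Icc 0 T, v t = x₀ + ∫ s in (0 : ℝ)..t, N v s) : EqOn u v (Icc 0 T) := by
  obtain ⟨D, hD⟩ := isCompact_Icc.exists_bound_of_continuousOn (hu.sub hv)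
  intro t ht
  have hD0 : 0 ≤ D := (norm_nonneg _).trans (hD t ht)
  have key : ∀ n : ℕ, ∀ t ∈ Icc 0 T, ‖u t - v t‖ ≤ D * ((C * t) ^ n / n.factorial) := by
    intro n
    induction n with
    | zero => intro t ht; simpa using hD t ht
    | succ n ih =>
      intro t ht
      rw [hu' t ht, hv' t ht, add_sub_add_left_eq_sub]
      exact hN.norm_integral_sub_le hu hv hD0 n ih t ht
  have lim := (FloorSemiring.tendsto_pow_div_factorial_atTop (C * t)).const_mul D
  rw [mul_zero] at lim
  have := ge_of_tendsto' lim (fun n => key n t ht)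
  exact sub_eq_zero.1 (norm_le_zero_iff.1 this)

/-- The Picard map need not contract on a long interval, but its `n`-th iterate has Lipschitz
constant at most `(C T)ⁿ / n!`, which is eventually below `1/2`. The fixed point of the contracting
iterate is fixed by the map itself. -/
lemma IsVolterra.exists_solution [CompleteSpace E] {N : (ℝ → E) → ℝ → E} {T C : ℝ} (hT : 0 ≤ T)
    (hN : IsVolterra N T C) (x₀ : E) :
    ∃ u : ℝ → E, ContinuousOn u (Icc 0 T) ∧
      ∀ t ∈ Icc 0 T, u t = x₀ + ∫ s in (0 : ℝ)..t, N u s := by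
  have hC := hN.nonneg
  have hext : ∀ u : C(Icc (0 : ℝ) T, E), ContinuousOn (IccExtend hT u) (Icc 0 T) :=
    fun u => (u.continuous.Icc_extend' (h := hT)).continuousOn
  let Φ : C(Icc (0 : ℝ) T, E) → C(Icc (0 : ℝ) T, E) := fun u =>
    ⟨fun t => x₀ + ∫ s in (0 : ℝ)..t, N (IccExtend hT u) s, by
      have := continuousOn_iff_continuous_domRestrict.1
        (continuousOn_primitive_Icc hT (hN.int _ (hext u)))
      exact continuous_const.add this⟩
  have hΦ : ∀ u t, Φ u t = x₀ + ∫ s in (0 : ℝ)..t, N (IccExtend hT u) s := fun _ _ => rfl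
  have key : ∀ (n : ℕ) (u v : C(Icc (0 : ℝ) T, E)), ∀ t (ht : t ∈ Icc 0 T),
      ‖(Φ^[n] u) ⟨t, ht⟩ - (Φ^[n] v) ⟨t, ht⟩‖ ≤ dist u v * ((C * t) ^ n / n.factorial) := by
    intro n u v
    induction n with
    | zero =>
      intro t ht
      simpa [dist_eq_norm] using ContinuousMap.dist_apply_le_dist (f := u) (g := v) ⟨t, ht⟩
    | succ n ih =>
      intro t ht
      rw [Function.iterate_succ_apply', Function.iterate_succ_apply', hΦ, hΦ,
        add_sub_add_left_eq_sub]
      refine hN.norm_integral_sub_le (hext _) (hext _) dist_nonneg n (fun t ht => ?_) t ht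
      rw [IccExtend_of_mem hT _ ht, IccExtend_of_mem hT _ ht]
      exact ih t ht
  have lim := FloorSemiring.tendsto_pow_div_factorial_atTop (C * T)
  obtain ⟨n, hn⟩ := (lim.eventually (gt_mem_nhds (by norm_num : (0 : ℝ) < 1 / 2))).exists
  have hcontr : ContractingWith (1 / 2 : NNReal) (Φ^[n]) := by
    refine ⟨by rw [← NNReal.coe_lt_coe]; norm_num, LipschitzWith.of_dist_le_mul fun u v => ?_⟩
    rw [ContinuousMap.dist_le (by positivity)]
    rintro ⟨t, ht⟩
    rw [dist_eq_norm]
    refine (key n u v t ht).trans ?_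
    rw [mul_comm]
    have : (C * t) ^ n / n.factorial ≤ (C * T) ^ n / n.factorial := by
      have := ht.1
      have := ht.2
      gcongr
    push_cast
    exact mul_le_mul_of_nonneg_right (this.trans hn.le) dist_nonneg
  have : Nonempty C(Icc (0 : ℝ) T, E) := ⟨0⟩
  have hfix := hcontr.isFixedPt_fixedPoint_iterate
  set w := ContractingWith.fixedPoint (Φ^[n]) hcontr
  refine ⟨IccExtend hT w, hext w, fun t ht => ?_⟩
  rw [IccExtend_of_mem hT _ ht]
  conv_lhs => rw [← hfix.eq]
  exact hΦ w ⟨t, ht⟩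

end Volterra

/-! ### Absolutely continuous functions and their primitives -/

section AbsolutelyContinuous

variable {E F : Type*} [NormedAddCommGroup E] [NormedAddCommGroup F] {a b : ℝ}

lemma _root_.AbsolutelyContinuousOnInterval.of_dist_le {f : ℝ → E} {g : ℝ → F}
    (hg : AbsolutelyContinuousOnInterval g a b)
    (h : ∀ x ∈ uIcc a b, ∀ y ∈ uIcc a b, dist (f x) (f y) ≤ dist (g x) (g y)) :
    AbsolutelyContinuousOnInterval f a b := by
  rw [absolutelyContinuousOnInterval_iff] at hg ⊢
  intro ε hε
  obtain ⟨δ, hδ, H⟩ := hg ε hε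
  refine ⟨δ, hδ, fun I hI hs => (Finset.sum_le_sum fun i hi => ?_).trans_lt (H I hI hs)⟩
  exact h _ (hI.1 i hi).1 _ (hI.1 i hi).2

variable [NormedSpace ℝ E]

lemma absolutelyContinuousOnInterval_primitive {f : ℝ → E} {T : ℝ} (hT : 0 ≤ T)
    (hf : IntervalIntegrable f volume 0 T) :
    AbsolutelyContinuousOnInterval (fun t => ∫ s in (0 : ℝ)..t, f s) 0 T := by
  have hg := hf.norm.absolutelyContinuousOnInterval_intervalIntegral (c := 0) left_mem_uIcc
  refine hg.of_dist_le fun x hx y hy => ?_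
  rw [uIcc_of_le hT] at hx hy
  rw [dist_eq_norm, dist_eq_norm, intervalIntegral.integral_interval_sub_left
    (intervalIntegrable_of_mem_Icc hf hx) (intervalIntegrable_of_mem_Icc hf hy),
    intervalIntegral.integral_interval_sub_left
    (intervalIntegrable_of_mem_Icc hf.norm hx) (intervalIntegrable_of_mem_Icc hf.norm hy)]
  exact intervalIntegral.norm_integral_le_abs_integral_norm

/-- The difference of `u` and the primitive of `F` is absolutely continuous with derivative zero
almost everywhere, hence constant. -/
lemma _root_.AbsolutelyContinuousOnInterval.eq_add_integral [CompleteSpace E] {u F : ℝ → E} {T : ℝ}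
    (hT : 0 ≤ T) (hu : AbsolutelyContinuousOnInterval u 0 T)
    (hF : IntervalIntegrable F volume 0 T)
    (h : ∀ᵐ t, t ∈ Ioo 0 T → HasDerivAt u (F t) t) :
    ∀ t ∈ Icc 0 T, u t = u 0 + ∫ s in (0 : ℝ)..t, F s := by
  obtain ⟨C, hC⟩ := (hu.sub (absolutelyContinuousOnInterval_primitive hT hF)).const_of_ae_hasDerivAt_zero
    (by
      have h0 : ∀ᵐ t : ℝ, t ≠ 0 := by simp [ae_iff]
      have hT' : ∀ᵐ t : ℝ, t ≠ T := by simp [ae_iff]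
      filter_upwards [h, hF.ae_hasDerivAt_integral, h0, hT'] with t h1 h2 h3 h4 ht
      have ht' := ht
      rw [uIcc_of_le hT] at ht'
      have := (h1 ⟨lt_of_le_of_ne ht'.1 h3.symm, lt_of_le_of_ne ht'.2 h4⟩).sub
        (h2 ht 0 left_mem_uIcc)
      rwa [sub_self] at this)
  intro t ht
  rw [uIcc_of_le hT] at hC
  have h1 := hC t ht
  have h2 := hC 0 (left_mem_Icc.2 hT)
  simp only [Pi.sub_apply, intervalIntegral.integral_same, sub_zero] at h1 h2
  rw [h2, ← h1]
  abel

end AbsolutelyContinuous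

/-! ### The memory convolution -/

section Memory

/-- The Volterra convolution `∫₀ᵗ K(t - τ) φ(τ) dτ`. -/
noncomputable def memConv (K φ : ℝ → ℝ) (t : ℝ) : ℝ := ∫ τ in (0 : ℝ)..t, K (t - τ) * φ τ

variable {K : ℝ → ℝ} {T : ℝ}

lemma intervalIntegrable_reflect (hK : IntervalIntegrable K volume 0 T) {t : ℝ}
    (ht : t ∈ Icc 0 T) : IntervalIntegrable (fun τ => K (t - τ)) volume 0 t := by
  have := ((intervalIntegrable_of_mem_Icc hK ht).comp_sub_left t (by finiteness)).symm
  simpa using this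

lemma intervalIntegrable_memConv_integrand (hK : IntervalIntegrable K volume 0 T) {φ : ℝ → ℝ}
    (hφ : ContinuousOn φ (Icc 0 T)) {t : ℝ} (ht : t ∈ Icc 0 T) :
    IntervalIntegrable (fun τ => K (t - τ) * φ τ) volume 0 t := by
  refine (intervalIntegrable_reflect hK ht).mul_continuousOn (hφ.mono ?_)
  rw [uIcc_of_le ht.1]
  exact Icc_subset_Icc_right ht.2

lemma abs_memConv_sub_le (hK : IntervalIntegrable K volume 0 T) {φ ψ : ℝ → ℝ}
    (hφ : ContinuousOn φ (Icc 0 T)) (hψ : ContinuousOn ψ (Icc 0 T)) {t : ℝ} (ht : t ∈ Icc 0 T)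
    {D : ℝ} (h : ∀ s ∈ Icc 0 t, |φ s - ψ s| ≤ D) :
    |memConv K φ t - memConv K ψ t| ≤ (∫ s in (0 : ℝ)..T, |K s|) * D := by
  have hD : 0 ≤ D := (abs_nonneg _).trans (h 0 (left_mem_Icc.2 ht.1))
  rw [memConv, memConv, ← intervalIntegral.integral_sub
    (intervalIntegrable_memConv_integrand hK hφ ht) (intervalIntegrable_memConv_integrand hK hψ ht)]
  have h1 : |∫ τ in (0 : ℝ)..t, (K (t - τ) * φ τ - K (t - τ) * ψ τ)|
      ≤ ∫ τ in (0 : ℝ)..t, |K (t - τ)| * D := by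
    rw [← Real.norm_eq_abs]
    refine intervalIntegral.norm_integral_le_of_norm_le ht.1 (Filter.Eventually.of_forall ?_)
      ((intervalIntegrable_reflect hK ht).norm.mul_const D)
    intro s hs
    rw [← mul_sub, norm_mul]
    exact mul_le_mul_of_nonneg_left (h s (Ioc_subset_Icc_self hs)) (norm_nonneg _)
  refine h1.trans ?_
  rw [intervalIntegral.integral_mul_const]
  refine mul_le_mul_of_nonneg_right ?_ hD
  rw [intervalIntegral.integral_comp_sub_left (fun s => |K s|) t, sub_self, sub_zero]
  exact intervalIntegral.integral_mono_interval le_rfl ht.1 ht.2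
    (Filter.Eventually.of_forall fun s => abs_nonneg _) hK.norm

/-- On `(0, T]` this is the convolution over the whole line of `φ` and `K` cut off outside `[0, T]`,
and a convolution of two integrable functions is integrable. -/
lemma intervalIntegrable_memConv (hT : 0 ≤ T) (hK : IntervalIntegrable K volume 0 T) {φ : ℝ → ℝ}
    (hφ : ContinuousOn φ (Icc 0 T)) : IntervalIntegrable (memConv K φ) volume 0 T := by
  have h1 : Integrable ((Icc 0 T).indicator φ) :=
    (hφ.integrableOn_compact isCompact_Icc).integrable_indicator measurableSet_Icc
  have h2 : Integrable ((Ioc 0 T).indicator K) :=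
    ((intervalIntegrable_iff_integrableOn_Ioc_of_le hT).1 hK).integrable_indicator measurableSet_Ioc
  have h3 := h1.integrable_convolution (ContinuousLinearMap.mul ℝ ℝ) h2
  rw [intervalIntegrable_iff_integrableOn_Ioc_of_le hT]
  refine h3.integrableOn.congr_fun (fun t ht => ?_) measurableSet_Ioc
  -- With `τ` in `[0, t)` the difference `t - τ` lies in `(0, T]`, the set on which `K` is kept; the
  -- two integrands then agree at every `τ`.
  rw [memConv, intervalIntegral.integral_of_le ht.1.le, ← integral_Ico_eq_integral_Ioc,
    ← integral_indicator measurableSet_Ico]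
  simp only [MeasureTheory.convolution, ContinuousLinearMap.mul_apply']
  congr 1
  ext τ
  have ht1 := ht.1
  have ht2 := ht.2
  by_cases hτ : τ ∈ Ico 0 t
  · have a1 : τ ∈ Icc 0 T := ⟨hτ.1, hτ.2.le.trans ht2⟩
    have a2 : t - τ ∈ Ioc 0 T := ⟨by linarith [hτ.2], by linarith [hτ.1]⟩
    rw [indicator_of_mem hτ, indicator_of_mem a1, indicator_of_mem a2, mul_comm]
  · rw [indicator_of_notMem hτ]
    by_cases a1 : τ ∈ Icc 0 T
    · have a2 : t - τ ∉ Ioc 0 T := fun a2 => hτ ⟨a1.1, by linarith [a2.1]⟩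
      rw [indicator_of_notMem a2, mul_zero]
    · rw [indicator_of_notMem a1, zero_mul]

lemma IsPositiveKernel.intervalIntegrable (hT : 0 ≤ T) (hK : IsPositiveKernel K T) :
    IntervalIntegrable K volume 0 T := by
  rw [intervalIntegrable_iff_integrableOn_Ioo_of_le hT]
  exact hK.1

lemma IsPositiveKernel.integral_memConv_mul_nonneg (hK : IsPositiveKernel K T) {φ : ℝ → ℝ}
    (hφ : ContinuousOn φ (Icc 0 T)) {S : ℝ} (hS : S ∈ Icc 0 T) :
    0 ≤ ∫ t in (0 : ℝ)..S, memConv K φ t * φ t := by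
  rcases hS.1.eq_or_lt with rfl | h0
  · simp
  have hφS : ContinuousOn φ (Icc 0 S) := hφ.mono (Icc_subset_Icc_right hS.2)
  obtain ⟨C, hC⟩ := isCompact_Icc.exists_bound_of_continuousOn hφS
  have hm : MemLp φ 2 (volume.restrict (Ioo 0 S)) := by
    refine MemLp.of_bound ((hφS.mono Ioo_subset_Icc_self).aestronglyMeasurable measurableSet_Ioo) C ?_
    exact (ae_restrict_iff' measurableSet_Ioo).2
      (Filter.Eventually.of_forall fun t ht => hC t (Ioo_subset_Icc_self ht))
  have := hK.2 S h0 hS.2 φ hm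
  simpa only [memConv, ← intervalIntegral.integral_mul_const] using this

end Memory

/-! ### Truncation by radial retraction -/

section Truncation

variable {V : Type*} [NormedAddCommGroup V] [NormedSpace ℝ V]

/-- The radial retraction onto the closed ball of radius `R`. -/
noncomputable def radialRetract (R : ℝ) (u : V) : V := (R / max R ‖u‖) • u

lemma radialRetract_eq_self {R : ℝ} (hR : 0 < R) {u : V} (hu : ‖u‖ ≤ R) :
    radialRetract R u = u := by
  rw [radialRetract, max_eq_left hu, div_self hR.ne', one_smul]

lemma norm_radialRetract_le {R : ℝ} (hR : 0 < R) (u : V) : ‖radialRetract R u‖ ≤ R := by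
  have h : 0 < max R ‖u‖ := lt_max_of_lt_left hR
  rw [radialRetract, norm_smul, Real.norm_of_nonneg (by positivity), div_mul_eq_mul_div,
    div_le_iff₀ h]
  exact mul_le_mul_of_nonneg_left (le_max_right _ _) hR.le

lemma norm_radialRetract_sub_le {R : ℝ} (hR : 0 < R) (u v : V) :
    ‖radialRetract R u - radialRetract R v‖ ≤ 2 * ‖u - v‖ := by
  set a := max R ‖u‖ with ha
  set b := max R ‖v‖ with hb
  have ha0 : 0 < a := lt_max_of_lt_left hR
  have hb0 : 0 < b := lt_max_of_lt_left hR
  have hRa : R / a ≤ 1 := (div_le_one ha0).2 (le_max_left _ _)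
  have hvb : ‖v‖ / b ≤ 1 := (div_le_one hb0).2 (le_max_right _ _)
  have hab : |b - a| ≤ ‖u - v‖ := by
    rw [abs_sub_comm, ha, hb, max_comm R, max_comm R]
    exact (abs_max_sub_max_le_abs _ _ _).trans (abs_norm_sub_norm_le u v)
  -- One part moves the vector and the other the scaling factor; each costs at most `‖u - v‖`,
  -- whence the constant 2 in any normed space.
  have e : radialRetract R u - radialRetract R v
      = (R / a) • (u - v) + ((R / a) * ((b - a) / b)) • v := by
    rw [radialRetract, radialRetract, ← ha, ← hb, smul_sub, sub_add, ← sub_smul]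
    congr 2
    field_simp
    ring
  rw [e]
  refine (norm_add_le _ _).trans ?_
  rw [norm_smul, norm_smul, norm_mul, Real.norm_of_nonneg (by positivity : 0 ≤ R / a), norm_div,
    Real.norm_of_nonneg hb0.le, Real.norm_eq_abs]
  have h1 : R / a * ‖u - v‖ ≤ 1 * ‖u - v‖ := by gcongr
  have h2 : R / a * (|b - a| / b) * ‖v‖ ≤ ‖u - v‖ := by
    calc R / a * (|b - a| / b) * ‖v‖ = R / a * |b - a| * (‖v‖ / b) := by ring
      _ ≤ 1 * ‖u - v‖ * 1 := by gcongr
      _ = ‖u - v‖ := by ring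
  linarith

end Truncation

/-- Gronwall's inequality: `(a + c ∫₀ᵗ y) e^{-ct}` has derivative `c e^{-ct} (y - a - c ∫₀ᵗ y) ≤ 0`,
so it never exceeds its initial value `a`. -/
lemma le_mul_exp_of_le_add_integral {y : ℝ → ℝ} {a c T : ℝ} (hT : 0 ≤ T) (hc : 0 ≤ c)
    (hy : ContinuousOn y (Icc 0 T))
    (h : ∀ t ∈ Icc 0 T, y t ≤ a + c * ∫ s in (0 : ℝ)..t, y s) :
    ∀ t ∈ Icc 0 T, y t ≤ a * Real.exp (c * t) := by
  have hi : IntervalIntegrable y volume 0 T := by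
    apply ContinuousOn.intervalIntegrable
    rwa [uIcc_of_le hT]
  intro t ht
  set Y : ℝ → ℝ := fun t => (a + c * ∫ s in (0 : ℝ)..t, y s) * Real.exp (-(c * t)) with hY
  have hcont : ContinuousOn Y (Icc 0 T) :=
    (continuousOn_const.add (continuousOn_const.mul (continuousOn_primitive_Icc hT hi))).mul
      (by fun_prop)
  have hder : ∀ s ∈ interior (Icc 0 T), HasDerivAt Y
      (c * y s * Real.exp (-(c * s)) + (a + c * ∫ s in (0 : ℝ)..s, y s) *
        (Real.exp (-(c * s)) * -c)) s := by
    intro s hs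
    rw [interior_Icc] at hs
    have hs' := Ioo_subset_Icc_self hs
    have hnhds : Icc 0 T ∈ nhds s := Icc_mem_nhds hs.1 hs.2
    have h1 : HasDerivAt (fun t => ∫ s in (0 : ℝ)..t, y s) (y s) s :=
      intervalIntegral.integral_hasDerivAt_right (intervalIntegrable_of_mem_Icc hi hs')
        (hy.stronglyMeasurableAtFilter_nhdsWithin measurableSet_Icc s |>.filter_mono
          (by rw [nhdsWithin_eq_nhds.2 hnhds])) (hy.continuousAt hnhds)
    have h2 : HasDerivAt (fun t => Real.exp (-(c * t))) (Real.exp (-(c * s)) * -c) s := by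
      have : HasDerivAt (fun t => -(c * t)) (-c) s := by
        simpa using ((hasDerivAt_id s).const_mul c).fun_neg
      exact this.exp
    exact ((h1.const_mul c).const_add a).mul h2
  have hanti : AntitoneOn Y (Icc 0 T) := by
    refine antitoneOn_of_deriv_nonpos (convex_Icc 0 T) hcont
      (fun s hs => (hder s hs).differentiableAt.differentiableWithinAt) fun s hs => ?_
    rw [(hder s hs).deriv]
    have := h s (interior_subset hs)
    have he := Real.exp_pos (-(c * s))
    have : c * Real.exp (-(c * s)) * (y s - (a + c * ∫ s in (0 : ℝ)..s, y s)) ≤ 0 :=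
      mul_nonpos_of_nonneg_of_nonpos (by positivity) (by linarith)
    linarith
  have h1 : Y t ≤ Y 0 := hanti (left_mem_Icc.2 hT) ht ht.1
  simp only [hY, intervalIntegral.integral_same, mul_zero, add_zero, neg_zero, Real.exp_zero,
    mul_one] at h1
  refine (h t ht).trans ?_
  rw [Real.exp_neg, ← div_eq_mul_inv, div_le_iff₀ (Real.exp_pos _)] at h1
  exact h1

/-- Functions that are Lipschitz on every ball. -/
def LipschitzOnBalls {V W : Type*} [NormedAddCommGroup V] [NormedAddCommGroup W] (F : V → W) :
    Prop :=
  ∀ R, ∃ L, 0 ≤ L ∧ ∀ u v, ‖u‖ ≤ R → ‖v‖ ≤ R → ‖F u - F v‖ ≤ L * ‖u - v‖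

lemma LipschitzOnBalls.continuous {V W : Type*} [NormedAddCommGroup V] [NormedAddCommGroup W]
    {F : V → W} (hF : LipschitzOnBalls F) : Continuous F := by
  rw [continuous_iff_continuousAt]
  intro u
  obtain ⟨L, -, h⟩ := hF (‖u‖ + 1)
  have hl : LipschitzOnWith (Real.toNNReal L) F (Metric.closedBall 0 (‖u‖ + 1)) :=
    LipschitzOnWith.of_dist_le' fun x hx y hy => by
      rw [dist_eq_norm, dist_eq_norm]
      exact h x y (mem_closedBall_zero_iff.1 hx) (mem_closedBall_zero_iff.1 hy)
  exact hl.continuousOn.continuousAt (Filter.mem_of_superset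
    (Metric.isOpen_ball.mem_nhds (mem_ball_zero_iff.2 (lt_add_one ‖u‖))) Metric.ball_subset_closedBall)

/-! ### Evolution equations with memory -/

section Evolution

variable {V : Type*} [NormedAddCommGroup V] [InnerProductSpace ℝ V] {ι : Type*} [Fintype ι]

/-- The right-hand side `g - A(u) - η ∑ⱼ (K * ⟪eⱼ, u⟫) eⱼ` of an evolution equation with memory. -/
noncomputable def evolutionRHS (A : V → V) (η : ℝ) (K : ℝ → ℝ) (e : ι → V) (g u : ℝ → V) (t : ℝ) :
    V :=
  g t - A (u t) - η • ∑ j, memConv K (fun τ => inner ℝ (e j) (u τ)) t • e j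

lemma intervalIntegrable_evolutionRHS {A : V → V} (hA : Continuous A) (η : ℝ) {T : ℝ} (hT : 0 ≤ T)
    {K : ℝ → ℝ} (hK : IntervalIntegrable K volume 0 T) (e : ι → V) {g : ℝ → V}
    (hg : IntervalIntegrable g volume 0 T) {u : ℝ → V} (hu : ContinuousOn u (Icc 0 T)) :
    IntervalIntegrable (evolutionRHS A η K e g u) volume 0 T := by
  have h1 : IntervalIntegrable (fun t => A (u t)) volume 0 T := by
    apply ContinuousOn.intervalIntegrable
    rw [uIcc_of_le hT]
    exact hA.comp_continuousOn hu
  have h2 : IntervalIntegrable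
      (fun t => ∑ j, memConv K (fun τ => inner ℝ (e j) (u τ)) t • e j) volume 0 T := by
    rw [intervalIntegrable_iff]
    refine integrable_finsetSum _ fun j _ => ?_
    exact (intervalIntegrable_iff.1
      (intervalIntegrable_memConv hT hK (continuousOn_const.inner hu))).smul_const _
  exact (hg.sub h1).sub (h2.smul η)

lemma inner_evolutionRHS (A : V → V) (η : ℝ) (K : ℝ → ℝ) (e : ι → V) (g u : ℝ → V) (t : ℝ)
    (χ : V) : inner ℝ (evolutionRHS A η K e g u t) χ = inner ℝ (g t) χ - inner ℝ (A (u t)) χ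
      - η * ∑ j, memConv K (fun τ => inner ℝ (e j) (u τ)) t * inner ℝ (e j) χ := by
  simp only [evolutionRHS, inner_sub_left, real_inner_smul_left, sum_inner]

/-- The memory terms are causal, and each contributes the `L¹` norm of `K` times `‖eⱼ‖²` to the
Lipschitz constant: one factor `‖eⱼ‖` from the inner product, one from the direction. -/
lemma isVolterra_evolutionRHS {A : V → V} {L : ℝ} (hL : 0 ≤ L)
    (hA : ∀ u v, ‖A u - A v‖ ≤ L * ‖u - v‖) {η T : ℝ} (hη : 0 ≤ η) (hT : 0 ≤ T) {K : ℝ → ℝ}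
    (hK : IntervalIntegrable K volume 0 T) (e : ι → V) {g : ℝ → V}
    (hg : IntervalIntegrable g volume 0 T) :
    IsVolterra (evolutionRHS A η K e g) T
      (L + η * ∑ j, (∫ s in (0 : ℝ)..T, |K s|) * ‖e j‖ * ‖e j‖) := by
  have hK0 : 0 ≤ ∫ s in (0 : ℝ)..T, |K s| :=
    intervalIntegral.integral_nonneg hT fun _ _ => abs_nonneg _
  have hAc : Continuous A :=
    (LipschitzWith.of_dist_le' (K := L) fun u v => by
      simpa only [dist_eq_norm] using hA u v).continuous
  have hin : ∀ (j : ι) (u : ℝ → V), ContinuousOn u (Icc 0 T) →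
      ContinuousOn (fun τ => inner ℝ (e j) (u τ)) (Icc 0 T) :=
    fun j u hu => continuousOn_const.inner hu
  refine ⟨by positivity, fun u hu => intervalIntegrable_evolutionRHS hAc η hT hK e hg hu,
    fun u v hu hv t ht D hD h => ?_⟩
  · have e1 : evolutionRHS A η K e g u t - evolutionRHS A η K e g v t
        = -(A (u t) - A (v t)) - η • ∑ j, (memConv K (fun τ => inner ℝ (e j) (u τ)) t
          - memConv K (fun τ => inner ℝ (e j) (v τ)) t) • e j := by
      simp only [evolutionRHS, sub_smul, Finset.sum_sub_distrib, smul_sub]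
      abel
    rw [e1]
    refine (norm_sub_le _ _).trans ?_
    rw [norm_neg, norm_smul, Real.norm_of_nonneg hη, add_mul, mul_assoc η]
    refine add_le_add ((hA _ _).trans ?_) (mul_le_mul_of_nonneg_left ?_ hη)
    · exact mul_le_mul_of_nonneg_left (h t (right_mem_Icc.2 ht.1)) hL
    · rw [Finset.sum_mul]
      refine (norm_sum_le _ _).trans (Finset.sum_le_sum fun j _ => ?_)
      rw [norm_smul, Real.norm_eq_abs]
      have := abs_memConv_sub_le hK (hin j u hu) (hin j v hv) ht (D := ‖e j‖ * D) fun s hs => by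
        rw [← inner_sub_right]
        exact (abs_real_inner_le_norm _ _).trans
          (mul_le_mul_of_nonneg_left (h s hs) (norm_nonneg _))
      refine (mul_le_mul_of_nonneg_right this (norm_nonneg _)).trans (le_of_eq (by ring))

lemma lipschitz_comp_radialRetract {A : V → V} {R L : ℝ} (hR : 0 < R) (hL : 0 ≤ L)
    (hA : ∀ u v, ‖u‖ ≤ R → ‖v‖ ≤ R → ‖A u - A v‖ ≤ L * ‖u - v‖) (u v : V) :
    ‖A (radialRetract R u) - A (radialRetract R v)‖ ≤ (2 * L) * ‖u - v‖ := by
  refine (hA _ _ (norm_radialRetract_le hR u) (norm_radialRetract_le hR v)).trans ?_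
  have := mul_le_mul_of_nonneg_left (norm_radialRetract_sub_le hR u v) hL
  linarith

lemma evolutionRHS_radialRetract (A : V → V) (η : ℝ) (K : ℝ → ℝ) (e : ι → V) (g u : ℝ → V)
    {R t : ℝ} (hR : 0 < R) (hu : ‖u t‖ ≤ R) :
    evolutionRHS (fun x => A (radialRetract R x)) η K e g u t = evolutionRHS A η K e g u t := by
  simp only [evolutionRHS, radialRetract_eq_self hR hu]

lemma integral_evolutionRHS_radialRetract (A : V → V) (η : ℝ) (K : ℝ → ℝ) (e : ι → V)
    (g u : ℝ → V) {R T t : ℝ} (hR : 0 < R) (hu : ∀ s ∈ Icc 0 T, ‖u s‖ ≤ R) (ht : t ∈ Icc 0 T) :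
    ∫ s in (0 : ℝ)..t, evolutionRHS (fun x => A (radialRetract R x)) η K e g u s
      = ∫ s in (0 : ℝ)..t, evolutionRHS A η K e g u s := by
  refine intervalIntegral.integral_congr fun s hs => ?_
  rw [uIcc_of_le ht.1] at hs
  exact evolutionRHS_radialRetract A η K e g u hR (hu s ⟨hs.1, hs.2.trans ht.2⟩)

/-- Solutions of the evolution equation are unique if `A` is Lipschitz on bounded sets. -/
theorem evolution_unique {A : V → V}
    (hA : LipschitzOnBalls A)
    {η T : ℝ} (hη : 0 ≤ η) (hT : 0 ≤ T) {K : ℝ → ℝ} (hK : IntervalIntegrable K volume 0 T)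
    (e : ι → V) {g : ℝ → V} (hg : IntervalIntegrable g volume 0 T) {x₀ : V} {u v : ℝ → V}
    (hu : ContinuousOn u (Icc 0 T)) (hv : ContinuousOn v (Icc 0 T))
    (hu' : ∀ t ∈ Icc 0 T, u t = x₀ + ∫ s in (0 : ℝ)..t, evolutionRHS A η K e g u s)
    (hv' : ∀ t ∈ Icc 0 T, v t = x₀ + ∫ s in (0 : ℝ)..t, evolutionRHS A η K e g v s) :
    EqOn u v (Icc 0 T) := by
  obtain ⟨R₁, h₁⟩ := isCompact_Icc.exists_bound_of_continuousOn hu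
  obtain ⟨R₂, h₂⟩ := isCompact_Icc.exists_bound_of_continuousOn hv
  -- Both solutions stay in this ball, so both solve the equation truncated at `R`, which is
  -- globally Lipschitz.
  set R := max (max R₁ R₂) 1
  have hR : 0 < R := lt_max_of_lt_right one_pos
  have h₁' : ∀ s ∈ Icc 0 T, ‖u s‖ ≤ R := fun s hs =>
    (h₁ s hs).trans ((le_max_left _ _).trans (le_max_left _ _))
  have h₂' : ∀ s ∈ Icc 0 T, ‖v s‖ ≤ R := fun s hs =>
    (h₂ s hs).trans ((le_max_right _ _).trans (le_max_left _ _))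
  obtain ⟨L, hL, hAL⟩ := hA R
  refine (isVolterra_evolutionRHS (by positivity) (lipschitz_comp_radialRetract hR hL hAL) hη hT hK
    e hg).eqOn (x₀ := x₀) hu hv (fun t ht => ?_) (fun t ht => ?_)
  · rw [integral_evolutionRHS_radialRetract A η K e g u hR h₁' ht]
    exact hu' t ht
  · rw [integral_evolutionRHS_radialRetract A η K e g v hR h₂' ht]
    exact hv' t ht

/-- Testing the memory with `u` splits it into the scalar forms `∫ (K * φⱼ) φⱼ` with `φⱼ = ⟪eⱼ, u⟫`,
and the kernel is positive on each of them. -/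
lemma integral_inner_memory_nonneg {T : ℝ} (hT : 0 ≤ T) {K : ℝ → ℝ} (hK : IsPositiveKernel K T)
    (e : ι → V) {u : ℝ → V} (hu : ContinuousOn u (Icc 0 T)) {S : ℝ} (hS : S ∈ Icc 0 T) :
    0 ≤ ∫ t in (0 : ℝ)..S,
      inner ℝ (∑ j, memConv K (fun τ => inner ℝ (e j) (u τ)) t • e j) (u t) := by
  have hin : ∀ j, ContinuousOn (fun τ => inner ℝ (e j) (u τ)) (Icc 0 T) :=
    fun j => continuousOn_const.inner hu
  simp only [sum_inner, real_inner_smul_left]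
  rw [intervalIntegral.integral_finsetSum]
  · exact Finset.sum_nonneg fun j _ => hK.integral_memConv_mul_nonneg (hin j) hS
  · intro j _
    refine (intervalIntegrable_of_mem_Icc
      (intervalIntegrable_memConv hT (hK.intervalIntegrable hT) (hin j)) hS).mul_continuousOn ?_
    rw [uIcc_of_le hS.1]
    exact (hin j).mono (Icc_subset_Icc_right hS.2)

lemma intervalIntegrable_inner_of_continuousOn {u F : ℝ → V} {a b : ℝ}
    (hu : ContinuousOn u (uIcc a b)) (hF : IntervalIntegrable F volume a b) :
    IntervalIntegrable (fun s => inner ℝ (u s) (F s)) volume a b := by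
  obtain ⟨C, hC⟩ := isCompact_uIcc.exists_bound_of_continuousOn hu
  refine (hF.norm.const_mul C).mono_fun ?_ ?_
  · exact ((hu.mono uIoc_subset_uIcc).aestronglyMeasurable measurableSet_uIoc).inner
      hF.def'.aestronglyMeasurable
  · refine (ae_restrict_iff' measurableSet_uIoc).2 (Filter.Eventually.of_forall fun s hs => ?_)
    have hs' := hC s (uIoc_subset_uIcc hs)
    have hC0 : 0 ≤ C := (norm_nonneg _).trans hs'
    simp only [norm_mul, norm_norm, Real.norm_of_nonneg hC0]
    exact (norm_inner_le_norm _ _).trans (mul_le_mul_of_nonneg_right hs' (norm_nonneg _))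

lemma norm_sq_eq_add_integral [CompleteSpace V] {u F : ℝ → V} {T : ℝ} (hT : 0 ≤ T)
    (hF : IntervalIntegrable F volume 0 T) (x₀ : V)
    (hu : ∀ t ∈ Icc 0 T, u t = x₀ + ∫ s in (0 : ℝ)..t, F s) :
    ∀ t ∈ Icc 0 T, ‖u t‖ ^ 2 = ‖x₀‖ ^ 2 + ∫ s in (0 : ℝ)..t, 2 * inner ℝ (u s) (F s) := by
  have hac : AbsolutelyContinuousOnInterval u 0 T := by
    refine (absolutelyContinuousOnInterval_primitive hT hF).of_dist_le fun x hx y hy => ?_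
    rw [uIcc_of_le hT] at hx hy
    rw [hu x hx, hu y hy, dist_add_left]
  obtain ⟨C, hC⟩ := hac.exists_bound
  have hac2 : AbsolutelyContinuousOnInterval (fun t => ‖u t‖ ^ 2) 0 T := by
    -- Since `‖u‖ ≤ C`, increments of `‖u‖²` are at most `2C` times those of `u`.
    refine (hac.const_smul (2 * C)).of_dist_le fun x hx y hy => ?_
    have hC0 : 0 ≤ C := (norm_nonneg _).trans (hC x hx)
    rw [dist_smul₀, dist_eq_norm, dist_eq_norm, Real.norm_of_nonneg (by positivity : 0 ≤ 2 * C),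
      sq_sub_sq, norm_mul]
    refine mul_le_mul ?_ (abs_norm_sub_norm_le _ _) (norm_nonneg _) (by positivity)
    rw [Real.norm_of_nonneg (by positivity)]
    linarith [hC x hx, hC y hy]
  have hu0 : u 0 = x₀ := by simpa using hu 0 (left_mem_Icc.2 hT)
  have hcont : ContinuousOn u (uIcc 0 T) := hac.continuousOn
  have hint : IntervalIntegrable (fun s => 2 * inner ℝ (u s) (F s)) volume 0 T :=
    (intervalIntegrable_inner_of_continuousOn hcont hF).const_mul 2
  have := hac2.eq_add_integral hT hint (by
    filter_upwards [hF.ae_hasDerivAt_integral] with t h1 ht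
    have ht' : t ∈ uIcc 0 T := by
      rw [uIcc_of_le hT]
      exact Ioo_subset_Icc_self ht
    have hd : HasDerivAt u (F t) t := by
      refine ((h1 ht' 0 left_mem_uIcc).const_add x₀).congr_of_eventuallyEq ?_
      filter_upwards [Icc_mem_nhds ht.1 ht.2] with s hs using hu s hs
    exact hd.norm_sq)
  simpa only [hu0] using this

/-- Solutions of the evolution equation exist if `A` is Lipschitz on bounded sets and
`⟪A u, u⟫ ≥ -C ‖u‖²`. -/
theorem evolution_exists [CompleteSpace V] {A : V → V}
    (hA : LipschitzOnBalls A)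
    {C : ℝ} (hC : 0 ≤ C) (hAC : ∀ u, -C * ‖u‖ ^ 2 ≤ inner ℝ (A u) u)
    {η T : ℝ} (hη : 0 ≤ η) (hT : 0 ≤ T) {K : ℝ → ℝ} (hK : IsPositiveKernel K T)
    (e : ι → V) {g : ℝ → V} (hg : IntervalIntegrable g volume 0 T)
    (hg2 : IntervalIntegrable (fun t => ‖g t‖ ^ 2) volume 0 T) (x₀ : V) :
    ∃ u : ℝ → V, ContinuousOn u (Icc 0 T) ∧
      IntervalIntegrable (evolutionRHS A η K e g u) volume 0 T ∧
      ∀ t ∈ Icc 0 T, u t = x₀ + ∫ s in (0 : ℝ)..t, evolutionRHS A η K e g u s := by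
  set a : ℝ := ‖x₀‖ ^ 2 + ∫ s in (0 : ℝ)..T, ‖g s‖ ^ 2 with ha
  set c : ℝ := 1 + 2 * C with hc
  have ha0 : 0 ≤ a := by
    have : 0 ≤ ∫ s in (0 : ℝ)..T, ‖g s‖ ^ 2 :=
      intervalIntegral.integral_nonneg hT fun _ _ => by positivity
    positivity
  -- The Gronwall bound for the truncated solution involves only the data, not `R`, so the radius
  -- can be chosen from it in advance. The added 1 makes the radius positive.
  set R : ℝ := Real.sqrt (a * Real.exp (c * T)) + 1 with hRdef
  have hR : 0 < R := by positivity
  obtain ⟨L, hL, hAL⟩ := hA R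
  have hV := isVolterra_evolutionRHS (by positivity) (lipschitz_comp_radialRetract hR hL hAL) hη hT
    (hK.intervalIntegrable hT) e hg
  obtain ⟨u, hu, hu'⟩ := hV.exists_solution hT x₀
  set F := evolutionRHS (fun x => A (radialRetract R x)) η K e g u with hF
  have hFi : IntervalIntegrable F volume 0 T := hV.int u hu
  -- Truncation keeps the lower bound: with `θ ∈ (0, 1]`, dividing `⟪A(θx), θx⟫ ≥ -C θ² ‖x‖²` by `θ`
  -- leaves `-C θ ‖x‖² ≥ -C ‖x‖²`.
  have hcoer : ∀ x, -C * ‖x‖ ^ 2 ≤ inner ℝ (A (radialRetract R x)) x := by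
    intro x
    set θ := R / max R ‖x‖ with hθ
    have hm : 0 < max R ‖x‖ := lt_max_of_lt_left hR
    have hθ0 : 0 < θ := by positivity
    have hθ1 : θ ≤ 1 := (div_le_one hm).2 (le_max_left _ _)
    have h1 := hAC (radialRetract R x)
    have h2 : radialRetract R x = θ • x := rfl
    nth_rw 3 [h2] at h1
    rw [real_inner_smul_right, h2, norm_smul, Real.norm_of_nonneg hθ0.le, mul_pow] at h1
    rw [h2]
    have h3 : -C * θ * ‖x‖ ^ 2 ≤ inner ℝ (A (θ • x)) x := by
      refine le_of_mul_le_mul_left ?_ hθ0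
      linarith
    have h4 : C * θ * ‖x‖ ^ 2 ≤ C * 1 * ‖x‖ ^ 2 := by gcongr
    linarith
  have hu2 : ContinuousOn (fun t => ‖u t‖ ^ 2) (Icc 0 T) := hu.norm.pow 2
  have hu2i : IntervalIntegrable (fun t => ‖u t‖ ^ 2) volume 0 T := by
    apply ContinuousOn.intervalIntegrable
    rwa [uIcc_of_le hT]
  have henergy : ∀ t ∈ Icc 0 T, ‖u t‖ ^ 2 ≤ a + c * ∫ s in (0 : ℝ)..t, ‖u s‖ ^ 2 := by
    intro t ht
    rw [norm_sq_eq_add_integral hT hFi x₀ hu' t ht]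
    have hmem := integral_inner_memory_nonneg hT hK e hu ht
    set m : ℝ → V := fun t => ∑ j, memConv K (fun τ => inner ℝ (e j) (u τ)) t • e j with hm
    have hgt := intervalIntegrable_of_mem_Icc hg2 ht
    have hut := intervalIntegrable_of_mem_Icc hu2i ht
    have hmi : IntervalIntegrable (fun t => inner ℝ (m t) (u t)) volume 0 T := by
      simp only [hm, sum_inner, real_inner_smul_left]
      rw [intervalIntegrable_iff]
      refine integrable_finsetSum _ fun j _ => ?_
      have hin : ContinuousOn (fun τ => inner ℝ (e j) (u τ)) (Icc 0 T) := continuousOn_const.inner hu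
      refine intervalIntegrable_iff.1 ((intervalIntegrable_memConv hT (hK.intervalIntegrable hT)
        hin).mul_continuousOn ?_)
      rwa [uIcc_of_le hT]
    have hmt := intervalIntegrable_of_mem_Icc hmi ht
    -- Young's inequality gives the 1 in `c = 1 + 2 C` and the lower bound on `A` gives `2 C`. The
    -- memory term is kept, because its sign is known only after integration.
    have hpt : ∀ s, 2 * inner ℝ (u s) (F s)
        ≤ ‖g s‖ ^ 2 + c * ‖u s‖ ^ 2 - 2 * η * inner ℝ (m s) (u s) := by
      intro s
      have e1 : inner ℝ (u s) (F s) = inner ℝ (g s) (u s) - inner ℝ (A (radialRetract R (u s))) (u s)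
          - η * inner ℝ (m s) (u s) := by
        rw [real_inner_comm, hF, evolutionRHS, inner_sub_left, inner_sub_left, real_inner_smul_left]
      have e2 := hcoer (u s)
      have e3 := real_inner_le_norm (g s) (u s)
      have e4 := sq_nonneg (‖g s‖ - ‖u s‖)
      rw [e1, hc]
      nlinarith
    have hle : ∫ s in (0 : ℝ)..t, 2 * inner ℝ (u s) (F s)
        ≤ ∫ s in (0 : ℝ)..t, (‖g s‖ ^ 2 + c * ‖u s‖ ^ 2 - 2 * η * inner ℝ (m s) (u s)) := by
      have hi := (intervalIntegrable_of_mem_Icc (intervalIntegrable_inner_of_continuousOn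
        (by rwa [uIcc_of_le hT]) hFi) ht).const_mul 2
      exact intervalIntegral.integral_mono_on ht.1 hi
          ((hgt.add (hut.const_mul c)).sub (hmt.const_mul _)) fun s _ => hpt s
    rw [intervalIntegral.integral_sub (hgt.add (hut.const_mul c)) (hmt.const_mul _),
      intervalIntegral.integral_add hgt (hut.const_mul c), intervalIntegral.integral_const_mul c,
      intervalIntegral.integral_const_mul (2 * η)] at hle
    have hgT : ∫ s in (0 : ℝ)..t, ‖g s‖ ^ 2 ≤ ∫ s in (0 : ℝ)..T, ‖g s‖ ^ 2 :=
      intervalIntegral.integral_mono_interval le_rfl ht.1 ht.2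
        (Filter.Eventually.of_forall fun s => by positivity) hg2
    have : 0 ≤ 2 * η * ∫ s in (0 : ℝ)..t, inner ℝ (m s) (u s) := by positivity
    linarith
  have hbound : ∀ t ∈ Icc 0 T, ‖u t‖ ≤ R := by
    intro t ht
    have h1 := le_mul_exp_of_le_add_integral hT (by positivity) hu2 henergy t ht
    have h2 : a * Real.exp (c * t) ≤ a * Real.exp (c * T) := by
      have := ht.2
      gcongr
    have := Real.le_sqrt_of_sq_le (h1.trans h2)
    linarith
  refine ⟨u, hu, ?_, fun t ht => ?_⟩
  · refine hFi.congr fun s hs => ?_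
    rw [uIoc_of_le hT] at hs
    exact evolutionRHS_radialRetract A η K e g u hR (hbound s (Ioc_subset_Icc_self hs))
  · rw [← integral_evolutionRHS_radialRetract A η K e g u hR hbound ht]
    exact hu' t ht

end Evolution

/-! ### Geometry of the mesh and finite dimension of the Crouzeix–Raviart space -/

section Geometry

variable {d : ℕ} {Ω : Set (Pt d)}

lemma IsSimplexCell.affineSpan_eq_top {T : Finset (Pt d)} (hT : IsSimplexCell T) :
    affineSpan ℝ (T : Set (Pt d)) = ⊤ := by
  have h := hT.2.affineSpan_eq_top_iff_card_eq_finrank_add_one.2 (by simp [hT.1])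
  simpa using h

lemma IsRectangleCell.affineSpan_eq_top {T : Finset (Pt 2)} (hT : IsRectangleCell T) :
    affineSpan ℝ (T : Set (Pt 2)) = ⊤ := by
  obtain ⟨p, a, b, ha, hb, hab, hTe⟩ := hT
  have hp : p ∈ (T : Set (Pt 2)) := by rw [hTe]; simp
  have hpa : p + a ∈ (T : Set (Pt 2)) := by rw [hTe]; simp
  have hpb : p + b ∈ (T : Set (Pt 2)) := by rw [hTe]; simp
  rw [AffineSubspace.affineSpan_eq_top_iff_vectorSpan_eq_top_of_nonempty ℝ _ _ ⟨p, hp⟩]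
  have hli : LinearIndependent ℝ ![a, b] := by
    refine linearIndependent_of_ne_zero_of_inner_eq_zero (𝕜 := ℝ) ?_ ?_
    · intro i
      fin_cases i
      · exact ha
      · exact hb
    · intro i j hij
      fin_cases i <;> fin_cases j
      · exact absurd rfl hij
      · exact hab
      · exact (real_inner_comm _ _).trans hab
      · exact absurd rfl hij
  have hspan := hli.span_eq_top_of_card_eq_finrank (by simp)
  rw [eq_top_iff, ← hspan, Submodule.span_le]
  rintro _ ⟨i, rfl⟩
  fin_cases i
  · simpa using vsub_mem_vectorSpan ℝ hpa hp
  · simpa using vsub_mem_vectorSpan ℝ hpb hp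

/-- Continuity upgrades the equality to all of `U`, and a nonempty open set affinely spans the whole
space. -/
lemma affineMap_eq_of_ae_eq {U : Set (Pt d)} (hU : IsOpen U) (hne : U.Nonempty) {p q : P1 d}
    (h : ∀ᵐ x ∂(volume.restrict U), p x = q x) : p = q := by
  have h1 : EqOn p q U := Measure.eqOn_open_of_ae_eq h hU
    (AffineMap.continuous_of_finiteDimensional p).continuousOn
    (AffineMap.continuous_of_finiteDimensional q).continuousOn
  ext x
  have hx : x ∈ affineSpan ℝ U := by
    rw [hU.affineSpan_eq_top hne]
    exact AffineSubspace.mem_top _ _ _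
  refine affineSpan_induction hx (p := fun x => p x = q x) (fun x hx => h1 hx) ?_
  intro c u v w hu hv hw
  rw [AffineMap.map_vadd, AffineMap.map_vadd, map_smul, map_smul, AffineMap.linearMap_vsub,
    AffineMap.linearMap_vsub, hu, hv, hw]

lemma isCompact_cell (T : Finset (Pt d)) : IsCompact (cell T) :=
  T.finite_toSet.isCompact_convexHull (𝕜 := ℝ)

namespace Mesh

variable (M : Mesh d Ω)

/-- Every cell of the mesh has an interior point in `Ω`. -/
def HasInteriorCells : Prop := ∀ T ∈ M.cells, (interior (cell T) ∩ Ω).Nonempty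

/-- The vertices of a cell affinely span the space, so the cell has interior. This interior lies in
that of `closure Ω`, which is `Ω` because `Ω` is open and convex. -/
lemma hasInteriorCells (hΩ_open : IsOpen Ω) (hΩ_conv : Convex ℝ Ω) (hΩ_ne : Ω.Nonempty) :
    M.HasInteriorCells := by
  intro T hT
  have h1 : (interior (cell T)).Nonempty := by
    rw [cell, interior_convexHull_nonempty_iff_affineSpan_eq_top]
    rcases M.shape with h | ⟨rfl, h⟩
    · exact (h T hT).affineSpan_eq_top
    · exact (h T hT).affineSpan_eq_top
  have h2 : cell T ⊆ closure Ω := by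
    rw [← M.cover]
    exact subset_biUnion_of_mem (u := fun T => cell T) hT
  have h3 : interior (closure Ω) = Ω := by
    rw [hΩ_conv.interior_closure_eq_interior_of_nonempty_interior (by rwa [hΩ_open.interior_eq]),
      hΩ_open.interior_eq]
  rw [inter_eq_left.2 ((interior_mono h2).trans h3.subset)]
  exact h1

variable {M}

lemma localPoly_represents {v : L2 Ω} (hv : v ∈ M.crSpace) : M.Represents (M.localPoly v) v := by
  have h : ∃ p, M.Represents p v := ⟨hv.choose, hv.choose_spec.1⟩
  rw [localPoly, dif_pos h]
  exact h.choose_spec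

/-- Both pieces agree almost everywhere on the nonempty open set `interior (cell T) ∩ Ω`. Thus the
choice made in `localPoly` is forced on the cells, which makes it linear in the function. -/
lemma Represents.unique (hM : M.HasInteriorCells) (hΩ : IsOpen Ω) {v : L2 Ω}
    {p q : Finset (Pt d) → P1 d} (hp : M.Represents p v) (hq : M.Represents q v)
    {T : Finset (Pt d)} (hT : T ∈ M.cells) : p T = q T := by
  refine affineMap_eq_of_ae_eq (isOpen_interior.inter hΩ) (hM T hT) ?_
  have h1 := ae_restrict_of_ae_restrict_of_subset (inter_subset_right (s := interior (cell T)))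
    (hp T hT)
  have h2 := ae_restrict_of_ae_restrict_of_subset (inter_subset_right (s := interior (cell T)))
    (hq T hT)
  filter_upwards [h1, h2, ae_restrict_mem (isOpen_interior.inter hΩ).measurableSet] with x h1 h2 hx
  have hx' := interior_subset hx.1
  rw [← h1 hx', h2 hx']

lemma localPoly_add (hM : M.HasInteriorCells) (hΩ : IsOpen Ω) {v w : L2 Ω} (hv : v ∈ M.crSpace)
    (hw : w ∈ M.crSpace) {T : Finset (Pt d)} (hT : T ∈ M.cells) :
    M.localPoly (v + w) T = M.localPoly v T + M.localPoly w T := by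
  refine (localPoly_represents (M.crSpace.add_mem hv hw)).unique hM hΩ
    (q := M.localPoly v + M.localPoly w) (fun S hS => ?_) hT
  filter_upwards [Lp.coeFn_add v w, localPoly_represents hv S hS, localPoly_represents hw S hS]
    with x hx h1 h2 hxS
  exact hx.trans (congrArg₂ (· + ·) (h1 hxS) (h2 hxS))

lemma localPoly_smul (hM : M.HasInteriorCells) (hΩ : IsOpen Ω) (c : ℝ) {v : L2 Ω}
    (hv : v ∈ M.crSpace) {T : Finset (Pt d)} (hT : T ∈ M.cells) :
    M.localPoly (c • v) T = c • M.localPoly v T := by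
  refine (localPoly_represents (M.crSpace.smul_mem c hv)).unique hM hΩ
    (q := c • M.localPoly v) (fun S hS => ?_) hT
  filter_upwards [Lp.coeFn_smul c v, localPoly_represents hv S hS] with x hx h1 hxS
  exact hx.trans (congrArg (c • ·) (h1 hxS))

/-- The restriction of functions of the Crouzeix-Raviart space to a cell. -/
noncomputable def restrictCell (hM : M.HasInteriorCells) (hΩ : IsOpen Ω) (T : M.cells) :
    M.crSpace →ₗ[ℝ] P1 d where
  toFun v := M.localPoly v T
  map_add' v w := localPoly_add hM hΩ v.2 w.2 T.2
  map_smul' c v := localPoly_smul hM hΩ c v.2 T.2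

lemma ae_exists_cell (M : Mesh d Ω) (hΩ : IsOpen Ω) :
    ∀ᵐ x ∂(volume.restrict Ω), ∃ T ∈ M.cells, x ∈ cell T := by
  filter_upwards [ae_restrict_mem hΩ.measurableSet] with x hx
  have : x ∈ ⋃ T ∈ M.cells, cell T := by
    rw [M.cover]
    exact subset_closure hx
  simpa using this

lemma ae_eq_localPoly {v : L2 Ω} (hv : v ∈ M.crSpace) :
    ∀ᵐ x ∂(volume.restrict Ω), ∀ T ∈ M.cells, x ∈ cell T → v x = M.localPoly v T x :=
  (Filter.eventually_all_finset M.cells).2 fun T hT => localPoly_represents hv T hT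

/-- The cells cover `Ω`, so a function whose affine pieces all vanish is zero: the space embeds in a
finite product of copies of `P1 d`. -/
lemma finiteDimensional_crSpace (hM : M.HasInteriorCells) (hΩ : IsOpen Ω) :
    FiniteDimensional ℝ M.crSpace := by
  refine Module.Finite.of_injective (LinearMap.pi (restrictCell hM hΩ)) ?_
  rw [injective_iff_map_eq_zero]
  intro v hv
  have hv' : ∀ T ∈ M.cells, M.localPoly v T = 0 := fun T hT => congrFun hv ⟨T, hT⟩
  ext1
  refine Lp.ext ?_
  filter_upwards [ae_exists_cell M hΩ, ae_eq_localPoly v.2,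
    Lp.coeFn_zero ℝ 2 (volume.restrict Ω)] with x ⟨T, hT, hx⟩ h h0
  rw [h T hT hx, hv' T hT, Submodule.coe_zero, h0]
  rfl

/-- Restriction of affine functions to a cell, as a linear map into the continuous functions. -/
noncomputable def toContinuousOnCell (T : Finset (Pt d)) : P1 d →ₗ[ℝ] C(cell T, ℝ) where
  toFun p := ⟨fun x => p x, (AffineMap.continuous_of_finiteDimensional p).comp continuous_subtype_val⟩
  map_add' _ _ := rfl
  map_smul' _ _ := rfl

/-- A linear map from a finite-dimensional space into the continuous functions on the compact cell
is bounded, and `B` is its operator norm. -/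
lemma exists_bound_localPoly (hM : M.HasInteriorCells) (hΩ : IsOpen Ω) {T : Finset (Pt d)}
    (hT : T ∈ M.cells) :
    ∃ B, 0 ≤ B ∧ ∀ v ∈ M.crSpace, ∀ x ∈ cell T, |M.localPoly v T x| ≤ B * ‖v‖ := by
  have := finiteDimensional_crSpace hM hΩ
  have : CompactSpace (cell T) := isCompact_iff_compactSpace.1 (isCompact_cell T)
  let L : M.crSpace →L[ℝ] C(cell T, ℝ) :=
    LinearMap.toContinuousLinearMap ((toContinuousOnCell T).comp (restrictCell hM hΩ ⟨T, hT⟩))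
  refine ⟨‖L‖, L.opNorm_nonneg, fun v hv x hx => ?_⟩
  exact ((L ⟨v, hv⟩).norm_coe_le_norm ⟨x, hx⟩).trans (L.le_opNorm ⟨v, hv⟩)

/-- The partial derivative on a cell, as a linear functional on the Crouzeix-Raviart space. -/
noncomputable def pderivₗ (hM : M.HasInteriorCells) (hΩ : IsOpen Ω) (T : M.cells) (i : Fin d) :
    M.crSpace →ₗ[ℝ] ℝ where
  toFun v := M.pderiv v T i
  map_add' v w := by
    simp [pderiv, localPoly_add hM hΩ v.2 w.2 T.2]
  map_smul' c v := by
    simp [pderiv, localPoly_smul hM hΩ c v.2 T.2]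

lemma exists_ae_bound (hM : M.HasInteriorCells) (hΩ : IsOpen Ω) :
    ∃ B, 0 ≤ B ∧ ∀ v ∈ M.crSpace, ∀ᵐ x ∂(volume.restrict Ω), |v x| ≤ B * ‖v‖ := by
  choose! B hB hB' using fun (T : Finset (Pt d)) (hT : T ∈ M.cells) =>
    exists_bound_localPoly hM hΩ hT
  refine ⟨∑ T ∈ M.cells, B T, Finset.sum_nonneg hB, fun v hv => ?_⟩
  filter_upwards [ae_exists_cell M hΩ, ae_eq_localPoly hv] with x ⟨T, hT, hx⟩ h
  rw [h T hT hx]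
  refine (hB' T hT v hv x hx).trans (mul_le_mul_of_nonneg_right ?_ (norm_nonneg _))
  exact Finset.single_le_sum (f := B) hB hT

end Mesh

end Geometry

/-! ### Calculus of maps that are Lipschitz on bounded sets -/

section BallLipschitz

variable {V X : Type*} [NormedAddCommGroup V] [MeasurableSpace X]

/-- A family of functions on `X`, indexed by a normed space, that is bounded and Lipschitz on
bounded subsets of the index space, uniformly almost everywhere. -/
structure IsBallLipschitz (μ : Measure X) (φ : V → X → ℝ) : Prop where
  meas : ∀ u, AEStronglyMeasurable (φ u) μ
  bdd : ∀ R, ∃ C, 0 ≤ C ∧ ∀ u, ‖u‖ ≤ R → ∀ᵐ x ∂μ, |φ u x| ≤ C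
  lip : ∀ R, ∃ L, 0 ≤ L ∧ ∀ u v, ‖u‖ ≤ R → ‖v‖ ≤ R → ∀ᵐ x ∂μ, |φ u x - φ v x| ≤ L * ‖u - v‖

variable {μ : Measure X} {φ ψ : V → X → ℝ}

lemma IsBallLipschitz.of_linear (hm : ∀ u, AEStronglyMeasurable (φ u) μ) {B : ℝ} (hB : 0 ≤ B)
    (h : ∀ u, ∀ᵐ x ∂μ, |φ u x| ≤ B * ‖u‖) (hsub : ∀ u v, ∀ᵐ x ∂μ, φ (u - v) x = φ u x - φ v x) :
    IsBallLipschitz μ φ := by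
  refine ⟨hm, fun R => ⟨B * |R|, by positivity, fun u hu => ?_⟩, fun R => ⟨B, hB, fun u v _ _ => ?_⟩⟩
  · filter_upwards [h u] with x hx
    exact hx.trans (mul_le_mul_of_nonneg_left (hu.trans (le_abs_self R)) hB)
  · filter_upwards [h (u - v), hsub u v] with x hx he
    rwa [← he]

lemma IsBallLipschitz.const_index {f : X → ℝ} (hm : AEStronglyMeasurable f μ) {C : ℝ} (hC : 0 ≤ C)
    (h : ∀ᵐ x ∂μ, |f x| ≤ C) : IsBallLipschitz μ (fun (_ : V) => f) :=
  ⟨fun _ => hm, fun _ => ⟨C, hC, fun _ _ => h⟩, fun _ => ⟨0, le_rfl, fun u v _ _ => by simp⟩⟩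

lemma IsBallLipschitz.mul (hφ : IsBallLipschitz μ φ) (hψ : IsBallLipschitz μ ψ) :
    IsBallLipschitz μ (fun u x => φ u x * ψ u x) := by
  refine ⟨fun u => (hφ.meas u).mul (hψ.meas u), fun R => ?_, fun R => ?_⟩
  · obtain ⟨C, hC, h1⟩ := hφ.bdd R
    obtain ⟨D, hD, h2⟩ := hψ.bdd R
    refine ⟨C * D, by positivity, fun u hu => ?_⟩
    filter_upwards [h1 u hu, h2 u hu] with x hx hy
    rw [abs_mul]
    gcongr
  · obtain ⟨C, hC, h1⟩ := hφ.bdd R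
    obtain ⟨D, hD, h2⟩ := hψ.bdd R
    obtain ⟨L, hL, h3⟩ := hφ.lip R
    obtain ⟨L', hL', h4⟩ := hψ.lip R
    refine ⟨L * D + C * L', by positivity, fun u v hu hv => ?_⟩
    filter_upwards [h1 v hv, h2 u hu, h3 u v hu hv, h4 u v hu hv] with x a1 a2 a3 a4
    have e : φ u x * ψ u x - φ v x * ψ v x
        = (φ u x - φ v x) * ψ u x + φ v x * (ψ u x - ψ v x) := by ring
    rw [e]
    refine (abs_add_le _ _).trans ?_
    rw [abs_mul, abs_mul]
    calc |φ u x - φ v x| * |ψ u x| + |φ v x| * |ψ u x - ψ v x|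
        ≤ (L * ‖u - v‖) * D + C * (L' * ‖u - v‖) := by gcongr
      _ = (L * D + C * L') * ‖u - v‖ := by ring

/-- On a ball of indices the values stay in a compact interval, where a locally Lipschitz function
is Lipschitz. -/
lemma IsBallLipschitz.comp {h : ℝ → ℝ} (hh : LocallyLipschitz h) (hφ : IsBallLipschitz μ φ) :
    IsBallLipschitz μ (fun u x => h (φ u x)) := by
  refine ⟨fun u => hh.continuous.comp_aestronglyMeasurable (hφ.meas u), fun R => ?_, fun R => ?_⟩
  · obtain ⟨C, hC, h1⟩ := hφ.bdd R
    obtain ⟨D, hD⟩ := (isCompact_Icc (a := -C) (b := C)).exists_bound_of_continuousOn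
      hh.continuous.continuousOn
    refine ⟨D, (norm_nonneg _).trans (hD 0 ⟨by linarith, hC⟩), fun u hu => ?_⟩
    filter_upwards [h1 u hu] with x hx
    exact hD _ (abs_le.1 hx)
  · obtain ⟨C, hC, h1⟩ := hφ.bdd R
    obtain ⟨L, hL, h3⟩ := hφ.lip R
    obtain ⟨k, hk⟩ := (hh.locallyLipschitzOn (s := Icc (-C) C)).exists_lipschitzOnWith_of_compact
      isCompact_Icc
    refine ⟨k * L, by positivity, fun u v hu hv => ?_⟩
    filter_upwards [h1 u hu, h1 v hv, h3 u v hu hv] with x a1 a2 a3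
    have := hk.dist_le_mul _ (abs_le.1 a1) _ (abs_le.1 a2)
    rw [Real.dist_eq, Real.dist_eq] at this
    rw [mul_assoc]
    exact this.trans (mul_le_mul_of_nonneg_left a3 k.2)

lemma IsBallLipschitz.integrable [IsFiniteMeasure μ] (hφ : IsBallLipschitz μ φ) (u : V) :
    Integrable (φ u) μ := by
  obtain ⟨C, _, h⟩ := hφ.bdd ‖u‖
  exact Integrable.of_bound (hφ.meas u) C (h u le_rfl)

lemma IsBallLipschitz.integral [IsFiniteMeasure μ] (hφ : IsBallLipschitz μ φ) :
    LipschitzOnBalls (fun u => ∫ x, φ u x ∂μ) := by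
  intro R
  obtain ⟨L, hL, h⟩ := hφ.lip R
  refine ⟨L * μ.real univ, by positivity, fun u v hu hv => ?_⟩
  rw [← integral_sub (hφ.integrable u) (hφ.integrable v)]
  refine (norm_integral_le_of_norm_le_const (h u v hu hv)).trans (le_of_eq (by ring))

section

variable {W : Type*} [NormedAddCommGroup W] {F G : V → W}

lemma LipschitzOnBalls.add (hF : LipschitzOnBalls F) (hG : LipschitzOnBalls G) :
    LipschitzOnBalls (fun u => F u + G u) := by
  intro R
  obtain ⟨L, hL, h⟩ := hF R
  obtain ⟨L', hL', h'⟩ := hG R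
  refine ⟨L + L', by positivity, fun u v hu hv => ?_⟩
  rw [add_sub_add_comm, add_mul]
  exact (norm_add_le _ _).trans (add_le_add (h u v hu hv) (h' u v hu hv))

lemma LipschitzOnBalls.const_smul [NormedSpace ℝ W] (hF : LipschitzOnBalls F) (c : ℝ) :
    LipschitzOnBalls (fun u => c • F u) := by
  intro R
  obtain ⟨L, hL, h⟩ := hF R
  refine ⟨‖c‖ * L, by positivity, fun u v hu hv => ?_⟩
  rw [← smul_sub, norm_smul, mul_assoc]
  exact mul_le_mul_of_nonneg_left (h u v hu hv) (norm_nonneg _)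

lemma LipschitzOnBalls.sum {ι : Type*} (s : Finset ι) {F : ι → V → W}
    (hF : ∀ i ∈ s, LipschitzOnBalls (F i)) : LipschitzOnBalls (fun u => ∑ i ∈ s, F i u) := by
  intro R
  choose! L hL h using fun i hi => hF i hi R
  refine ⟨∑ i ∈ s, L i, Finset.sum_nonneg hL, fun u v hu hv => ?_⟩
  rw [← Finset.sum_sub_distrib, Finset.sum_mul]
  exact (norm_sum_le _ _).trans (Finset.sum_le_sum fun i hi => h i hi u v hu hv)

/-- Expansion in an orthonormal basis reduces the claim to finitely many coordinates. It passes from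
the form `A_CR` to the operator representing it. -/
lemma LipschitzOnBalls.of_inner {V W : Type*} [NormedAddCommGroup V] [NormedAddCommGroup W]
    [InnerProductSpace ℝ W] [FiniteDimensional ℝ W] {F : V → W}
    (hF : ∀ w, LipschitzOnBalls (fun u => (inner ℝ (F u) w : ℝ))) : LipschitzOnBalls F := by
  set b := stdOrthonormalBasis ℝ W
  intro R
  choose L hL h using fun i => hF (b i) R
  refine ⟨∑ i, L i, Finset.sum_nonneg fun i _ => hL i, fun u v hu hv => ?_⟩
  rw [← b.sum_repr' (F u - F v), Finset.sum_mul]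
  refine (norm_sum_le _ _).trans (Finset.sum_le_sum fun i _ => ?_)
  rw [norm_smul, b.norm_eq_one, mul_one, real_inner_comm, inner_sub_left]
  exact h i u v hu hv

end

end BallLipschitz

/-! ### The power and the reaction term -/

section Nonlinearity

variable {κ δ γ : ℝ}

/-- Positive and negative parts remove the case distinction, so that local Lipschitz continuity
follows from that of `x ^ δ`; `0 ^ δ = 0` makes the idle part vanish. -/
lemma rpowκ_eq (hδ : 0 < δ) (s : ℝ) :
    rpowκ κ δ s = (max s 0) ^ δ + κ * (max (-s) 0) ^ δ := by
  unfold rpowκ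
  split_ifs with h
  · rw [max_eq_left h, max_eq_right (by linarith), Real.zero_rpow hδ.ne', mul_zero, add_zero]
  · have h' := not_le.1 h
    rw [max_eq_right h'.le, max_eq_left (by linarith), Real.zero_rpow hδ.ne', zero_add,
      abs_of_neg h']

lemma _root_.LocallyLipschitz.mul_real {f g : ℝ → ℝ} (hf : LocallyLipschitz f)
    (hg : LocallyLipschitz g) : LocallyLipschitz (fun x => f x * g x) := by
  have h : ContDiff ℝ 1 (fun p : ℝ × ℝ => p.1 * p.2) := by fun_prop
  exact h.locallyLipschitz.comp (hf.prodMk hg)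

lemma locallyLipschitz_rpowκ (hδ : 1 ≤ δ) : LocallyLipschitz (rpowκ κ δ) := by
  have h : LocallyLipschitz (fun x : ℝ => x ^ δ) :=
    (Real.contDiff_rpow_const_of_le (n := 1) (by simpa using hδ)).locallyLipschitz
  have h1 : LocallyLipschitz (fun s : ℝ => (max s 0) ^ δ) :=
    h.comp (LocallyLipschitz.id.max_const 0)
  have hneg : LocallyLipschitz (fun s : ℝ => -s) :=
    (contDiff_neg : ContDiff ℝ 1 (fun s : ℝ => -s)).locallyLipschitz
  have h2 : LocallyLipschitz (fun s : ℝ => (max (-s) 0) ^ δ) := h.comp (hneg.max_const 0)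
  rw [show rpowκ κ δ = fun s => (max s 0) ^ δ + κ * (max (-s) 0) ^ δ from
    funext fun s => rpowκ_eq (by linarith) s]
  exact h1.add ((LocallyLipschitz.const κ).mul_real h2)

lemma locallyLipschitz_cFun (hδ : 1 ≤ δ) : LocallyLipschitz (cFun κ δ γ) := by
  have h := locallyLipschitz_rpowκ (κ := κ) hδ
  exact (LocallyLipschitz.id.mul_real ((LocallyLipschitz.const 1).sub h)).mul_real
    (h.sub (LocallyLipschitz.const γ))

lemma cFun_mul_self_le (hγ : γ ∈ Ioo (0 : ℝ) 1) (s : ℝ) : cFun κ δ γ s * s ≤ s * s := by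
  set r := rpowκ κ δ s with hr
  -- From `4 (1 - r)(r - γ) = (1 - γ)² - (2r - 1 - γ)²`; this holds for every real `r`, so the value
  -- of `κ` plays no role.
  have h : (1 - r) * (r - γ) ≤ 1 := by nlinarith [sq_nonneg (2 * r - 1 - γ), hγ.1, hγ.2]
  have := mul_le_mul_of_nonneg_left h (mul_self_nonneg s)
  rw [cFun, ← hr]
  linarith

end Nonlinearity

/-! ### The form `A_CR`: linearity, Lipschitz continuity, lower bound -/

namespace Mesh

variable {d : ℕ} {Ω : Set (Pt d)} {M : Mesh d Ω}

instance isFiniteMeasure_restrict_cell (T : Finset (Pt d)) :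
    IsFiniteMeasure ((volume : Measure (Pt d)).restrict (cell T)) :=
  isFiniteMeasure_restrict.2 (isCompact_cell T).measure_lt_top.ne

lemma isBallLipschitz_localPoly (hM : M.HasInteriorCells) (hΩ : IsOpen Ω) {T : Finset (Pt d)}
    (hT : T ∈ M.cells) :
    IsBallLipschitz (volume.restrict (cell T))
      (fun (u : M.crSpace) x => M.localPoly u T x) := by
  obtain ⟨B, hB, h⟩ := exists_bound_localPoly hM hΩ hT
  refine IsBallLipschitz.of_linear (fun u =>
    (AffineMap.continuous_of_finiteDimensional _).aestronglyMeasurable) hB (fun u => ?_)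
    (fun u v => Filter.Eventually.of_forall fun x => ?_)
  · exact (ae_restrict_iff' (isCompact_cell T).measurableSet).2
      (Filter.Eventually.of_forall fun x hx => h u u.2 x hx)
  · have := (restrictCell hM hΩ ⟨T, hT⟩).map_sub u v
    exact congrArg (fun p : P1 d => p x) this

lemma isBallLipschitz_pderiv (hM : M.HasInteriorCells) (hΩ : IsOpen Ω) {T : Finset (Pt d)}
    (hT : T ∈ M.cells) (μ : Measure (Pt d)) :
    IsBallLipschitz μ (fun (u : M.crSpace) _ => ∑ i, M.pderiv u T i) := by
  have := finiteDimensional_crSpace hM hΩ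
  let L : M.crSpace →L[ℝ] ℝ :=
    LinearMap.toContinuousLinearMap (∑ i, pderivₗ hM hΩ ⟨T, hT⟩ i)
  have hL : ∀ u, L u = ∑ i, M.pderiv u T i := fun u => by
    simp only [L, LinearMap.coe_toContinuousLinearMap', LinearMap.sum_apply]
    rfl
  simp only [← hL]
  exact IsBallLipschitz.of_linear (fun u => aestronglyMeasurable_const) L.opNorm_nonneg
    (fun u => Filter.Eventually.of_forall fun x => L.le_opNorm u)
    (fun u v => Filter.Eventually.of_forall fun x => L.map_sub u v)

lemma isBallLipschitz_coeFn (hM : M.HasInteriorCells) (hΩ : IsOpen Ω) :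
    IsBallLipschitz (volume.restrict Ω) (fun (u : M.crSpace) x => (u : L2 Ω) x) := by
  obtain ⟨B, hB, h⟩ := exists_ae_bound hM hΩ
  exact IsBallLipschitz.of_linear (fun u => Lp.aestronglyMeasurable _) hB (fun u => h u u.2)
    (fun u v => Lp.coeFn_sub (u : L2 Ω) v)

variable {κ ν α β γ δ : ℝ}

lemma isBallLipschitz_convection_left (hM : M.HasInteriorCells) (hΩ : IsOpen Ω) (hδ : 1 ≤ δ)
    {T : Finset (Pt d)} (hT : T ∈ M.cells) :
    IsBallLipschitz (volume.restrict (cell T)) (fun (u : M.crSpace) x =>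
      rpowκ κ δ (M.localPoly u T x) * (∑ i, M.pderiv u T i)) :=
  ((isBallLipschitz_localPoly hM hΩ hT).comp (locallyLipschitz_rpowκ hδ)).mul
    (isBallLipschitz_pderiv hM hΩ hT _)

lemma isBallLipschitz_localPoly_const (hM : M.HasInteriorCells) (hΩ : IsOpen Ω)
    {T : Finset (Pt d)} (hT : T ∈ M.cells) (w : M.crSpace) :
    IsBallLipschitz (volume.restrict (cell T))
      (fun (_ : M.crSpace) x => M.localPoly w T x) := by
  obtain ⟨C, hC, h⟩ := (isBallLipschitz_localPoly hM hΩ hT).bdd ‖w‖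
  exact .const_index ((isBallLipschitz_localPoly hM hΩ hT).meas w) hC (h w le_rfl)

lemma isBallLipschitz_bCR_fst (hM : M.HasInteriorCells) (hΩ : IsOpen Ω) (hδ : 1 ≤ δ)
    {T : Finset (Pt d)} (hT : T ∈ M.cells) (w : M.crSpace) :
    IsBallLipschitz (volume.restrict (cell T)) (fun (u : M.crSpace) x =>
      rpowκ κ δ (M.localPoly u T x) * (∑ i, M.pderiv u T i) * M.localPoly w T x) :=
  (isBallLipschitz_convection_left hM hΩ hδ hT).mul (isBallLipschitz_localPoly_const hM hΩ hT w)

lemma isBallLipschitz_bCR_snd (hM : M.HasInteriorCells) (hΩ : IsOpen Ω) (hδ : 1 ≤ δ)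
    {T : Finset (Pt d)} (hT : T ∈ M.cells) (w : M.crSpace) :
    IsBallLipschitz (volume.restrict (cell T)) (fun (u : M.crSpace) x =>
      rpowκ κ δ (M.localPoly u T x) * (∑ i, M.pderiv w T i) * M.localPoly u T x) :=
  (((isBallLipschitz_localPoly hM hΩ hT).comp (locallyLipschitz_rpowκ hδ)).mul
    (.const_index aestronglyMeasurable_const (abs_nonneg (∑ i, M.pderiv w T i))
      (Filter.Eventually.of_forall fun _ => le_rfl))).mul (isBallLipschitz_localPoly hM hΩ hT)

lemma isBallLipschitz_reaction (hM : M.HasInteriorCells) (hΩ : IsOpen Ω) (hδ : 1 ≤ δ)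
    (w : M.crSpace) :
    IsBallLipschitz (volume.restrict Ω) (fun (u : M.crSpace) x =>
      cFun κ δ γ ((u : L2 Ω) x) * (w : L2 Ω) x) := by
  obtain ⟨C, hC, h⟩ := (isBallLipschitz_coeFn hM hΩ).bdd ‖w‖
  exact ((isBallLipschitz_coeFn hM hΩ).comp (locallyLipschitz_cFun hδ)).mul
    (.const_index (Lp.aestronglyMeasurable _) hC (h w le_rfl))

lemma gradInner_eq (G H : Finset (Pt d) → Pt d) :
    M.gradInner G H = ∑ T ∈ M.cells, volume.real (cell T) * ∑ i, G T i * H T i := by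
  refine Finset.sum_congr rfl fun T _ => ?_
  rw [setIntegral_const, smul_eq_mul, PiLp.inner_apply]
  simp [mul_comm]

lemma aCR_eq (u w : L2 Ω) : M.aCR u w
    = ∑ T ∈ M.cells, volume.real (cell T) * ∑ i, M.pderiv u T i * M.pderiv w T i :=
  gradInner_eq _ _

/-- For `w = u` the two halves of the skew-symmetrized form coincide, without any integration by
parts. -/
lemma bCR_self (u : L2 Ω) : M.bCR κ δ u u = 0 := sub_self _

lemma pderiv_add (hM : M.HasInteriorCells) (hΩ : IsOpen Ω) (v w : M.crSpace)
    {T : Finset (Pt d)} (hT : T ∈ M.cells) (i : Fin d) :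
    M.pderiv ((v + w : M.crSpace) : L2 Ω) T i = M.pderiv v T i + M.pderiv w T i :=
  (pderivₗ hM hΩ ⟨T, hT⟩ i).map_add v w

lemma pderiv_smul (hM : M.HasInteriorCells) (hΩ : IsOpen Ω) (c : ℝ) (v : M.crSpace)
    {T : Finset (Pt d)} (hT : T ∈ M.cells) (i : Fin d) :
    M.pderiv ((c • v : M.crSpace) : L2 Ω) T i = c * M.pderiv v T i :=
  (pderivₗ hM hΩ ⟨T, hT⟩ i).map_smul c v

lemma aCR_add (hM : M.HasInteriorCells) (hΩ : IsOpen Ω) (u : L2 Ω) (v w : M.crSpace) :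
    M.aCR u (v + w : M.crSpace) = M.aCR u v + M.aCR u w := by
  simp only [aCR_eq]
  rw [← Finset.sum_add_distrib]
  refine Finset.sum_congr rfl fun T hT => ?_
  simp only [pderiv_add hM hΩ v w hT, mul_add, Finset.sum_add_distrib]

lemma aCR_smul (hM : M.HasInteriorCells) (hΩ : IsOpen Ω) (u : L2 Ω) (c : ℝ) (v : M.crSpace) :
    M.aCR u (c • v : M.crSpace) = c * M.aCR u v := by
  simp only [aCR_eq]
  rw [Finset.mul_sum]
  refine Finset.sum_congr rfl fun T hT => ?_
  simp only [pderiv_smul hM hΩ c v hT, Finset.mul_sum]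
  exact Finset.sum_congr rfl fun i _ => by ring

lemma bCR_add (hM : M.HasInteriorCells) (hΩ : IsOpen Ω) (hδ : 1 ≤ δ) (u v w : M.crSpace) :
    M.bCR κ δ u (v + w : M.crSpace) = M.bCR κ δ u v + M.bCR κ δ u w := by
  have e1 : (∑ T ∈ M.cells, ∫ x in cell T, rpowκ κ δ (M.localPoly u T x) *
      (∑ i, M.pderiv u T i) * M.localPoly ((v + w : M.crSpace) : L2 Ω) T x)
      = (∑ T ∈ M.cells, ∫ x in cell T, rpowκ κ δ (M.localPoly u T x) *
        (∑ i, M.pderiv u T i) * M.localPoly v T x)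
      + ∑ T ∈ M.cells, ∫ x in cell T, rpowκ κ δ (M.localPoly u T x) *
        (∑ i, M.pderiv u T i) * M.localPoly w T x := by
    rw [← Finset.sum_add_distrib]
    refine Finset.sum_congr rfl fun T hT => ?_
    rw [← integral_add ((isBallLipschitz_bCR_fst hM hΩ hδ hT v).integrable u)
      ((isBallLipschitz_bCR_fst hM hΩ hδ hT w).integrable u), Submodule.coe_add,
      localPoly_add hM hΩ v.2 w.2 hT]
    simp only [AffineMap.coe_add, Pi.add_apply, mul_add]
  have e2 : (∑ T ∈ M.cells, ∫ x in cell T, rpowκ κ δ (M.localPoly u T x) *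
      (∑ i, M.pderiv ((v + w : M.crSpace) : L2 Ω) T i) * M.localPoly u T x)
      = (∑ T ∈ M.cells, ∫ x in cell T, rpowκ κ δ (M.localPoly u T x) *
        (∑ i, M.pderiv v T i) * M.localPoly u T x)
      + ∑ T ∈ M.cells, ∫ x in cell T, rpowκ κ δ (M.localPoly u T x) *
        (∑ i, M.pderiv w T i) * M.localPoly u T x := by
    rw [← Finset.sum_add_distrib]
    refine Finset.sum_congr rfl fun T hT => ?_
    rw [← integral_add ((isBallLipschitz_bCR_snd hM hΩ hδ hT v).integrable u)
      ((isBallLipschitz_bCR_snd hM hΩ hδ hT w).integrable u)]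
    simp only [pderiv_add hM hΩ v w hT, Finset.sum_add_distrib, mul_add, add_mul]
  rw [bCR, bCR, bCR, e1, e2]
  ring

lemma bCR_smul (hM : M.HasInteriorCells) (hΩ : IsOpen Ω) (u : L2 Ω) (c : ℝ) (v : M.crSpace) :
    M.bCR κ δ u (c • v : M.crSpace) = c * M.bCR κ δ u v := by
  have e1 : (∑ T ∈ M.cells, ∫ x in cell T, rpowκ κ δ (M.localPoly u T x) *
      (∑ i, M.pderiv u T i) * M.localPoly ((c • v : M.crSpace) : L2 Ω) T x)
      = c * ∑ T ∈ M.cells, ∫ x in cell T, rpowκ κ δ (M.localPoly u T x) *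
        (∑ i, M.pderiv u T i) * M.localPoly v T x := by
    rw [Finset.mul_sum]
    refine Finset.sum_congr rfl fun T hT => ?_
    rw [← integral_const_mul, Submodule.coe_smul, localPoly_smul hM hΩ c v.2 hT]
    simp only [AffineMap.coe_smul, Pi.smul_apply, smul_eq_mul, mul_left_comm c]
  have e2 : (∑ T ∈ M.cells, ∫ x in cell T, rpowκ κ δ (M.localPoly u T x) *
      (∑ i, M.pderiv ((c • v : M.crSpace) : L2 Ω) T i) * M.localPoly u T x)
      = c * ∑ T ∈ M.cells, ∫ x in cell T, rpowκ κ δ (M.localPoly u T x) *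
        (∑ i, M.pderiv v T i) * M.localPoly u T x := by
    rw [Finset.mul_sum]
    refine Finset.sum_congr rfl fun T hT => ?_
    rw [← integral_const_mul]
    simp only [pderiv_smul hM hΩ c v hT, ← Finset.mul_sum]
    exact integral_congr_ae (Filter.Eventually.of_forall fun x => by ring)
  rw [bCR, bCR, e1, e2]
  ring

lemma isFiniteMeasure_restrict_of_bdd (hb : Bornology.IsBounded Ω) :
    IsFiniteMeasure (volume.restrict Ω) :=
  isFiniteMeasure_restrict.2 hb.measure_lt_top.ne

lemma ACR_add (hM : M.HasInteriorCells) (hΩ : IsOpen Ω) (hb : Bornology.IsBounded Ω) (hδ : 1 ≤ δ)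
    (u v w : M.crSpace) :
    M.ACR κ ν α β γ δ u (v + w : M.crSpace)
      = M.ACR κ ν α β γ δ u v + M.ACR κ ν α β γ δ u w := by
  have := isFiniteMeasure_restrict_of_bdd hb
  have e : ∫ x in Ω, cFun κ δ γ ((u : L2 Ω) x) * ((v + w : M.crSpace) : L2 Ω) x
      = (∫ x in Ω, cFun κ δ γ ((u : L2 Ω) x) * (v : L2 Ω) x)
        + ∫ x in Ω, cFun κ δ γ ((u : L2 Ω) x) * (w : L2 Ω) x := by
    rw [← integral_add ((isBallLipschitz_reaction hM hΩ hδ v).integrable u)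
      ((isBallLipschitz_reaction hM hΩ hδ w).integrable u)]
    refine integral_congr_ae ?_
    filter_upwards [Lp.coeFn_add (v : L2 Ω) w] with x hx
    rw [Submodule.coe_add, hx, Pi.add_apply, mul_add]
  rw [ACR, ACR, ACR, aCR_add hM hΩ, bCR_add hM hΩ hδ, e]
  ring

lemma ACR_smul (hM : M.HasInteriorCells) (hΩ : IsOpen Ω) (u : L2 Ω) (c : ℝ) (v : M.crSpace) :
    M.ACR κ ν α β γ δ u (c • v : M.crSpace) = c * M.ACR κ ν α β γ δ u v := by
  have e : ∫ x in Ω, cFun κ δ γ (u x) * ((c • v : M.crSpace) : L2 Ω) x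
      = c * ∫ x in Ω, cFun κ δ γ (u x) * (v : L2 Ω) x := by
    rw [← integral_const_mul]
    refine integral_congr_ae ?_
    filter_upwards [Lp.coeFn_smul c (v : L2 Ω)] with x hx
    rw [Submodule.coe_smul, hx, Pi.smul_apply, smul_eq_mul]
    ring
  rw [ACR, ACR, aCR_smul hM hΩ, bCR_smul hM hΩ, e]
  ring

/-- Diffusion is linear in `u`; convection and reaction are integrals over finite measures of
products of families that are Lipschitz on balls. -/
lemma lipschitzOnBalls_ACR (hM : M.HasInteriorCells) (hΩ : IsOpen Ω) (hb : Bornology.IsBounded Ω)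
    (hδ : 1 ≤ δ) (w : M.crSpace) :
    LipschitzOnBalls (fun u : M.crSpace => M.ACR κ ν α β γ δ u w) := by
  have := isFiniteMeasure_restrict_of_bdd hb
  have hfd := finiteDimensional_crSpace hM hΩ
  have h1 : LipschitzOnBalls (fun u : M.crSpace => M.aCR u w) := by
    simp only [aCR_eq]
    refine LipschitzOnBalls.sum _ fun T hT => LipschitzOnBalls.const_smul (W := ℝ)
      (LipschitzOnBalls.sum _ fun i _ R => ?_) _
    let L : M.crSpace →L[ℝ] ℝ := LinearMap.toContinuousLinearMap (pderivₗ hM hΩ ⟨T, hT⟩ i)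
    refine ⟨‖L‖ * |M.pderiv w T i|, mul_nonneg L.opNorm_nonneg (abs_nonneg _), fun u v _ _ => ?_⟩
    rw [← sub_mul, norm_mul, mul_right_comm]
    refine mul_le_mul_of_nonneg_right ?_ (abs_nonneg _)
    have := L.le_opNorm (u - v)
    rwa [L.map_sub] at this
  have h2 : LipschitzOnBalls (fun u : M.crSpace => M.bCR κ δ u w) := by
    have a1 := (LipschitzOnBalls.sum M.cells
      fun T hT => (isBallLipschitz_bCR_fst (κ := κ) hM hΩ hδ hT w).integral).const_smul (1 / (δ + 2))
    have a2 := (LipschitzOnBalls.sum M.cells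
      fun T hT => (isBallLipschitz_bCR_snd (κ := κ) hM hΩ hδ hT w).integral).const_smul (-(1 / (δ + 2)))
    convert a1.add a2 using 2 with u
    rw [bCR, smul_eq_mul, smul_eq_mul]
    ring
  have h3 := (isBallLipschitz_reaction (κ := κ) (γ := γ) hM hΩ hδ w).integral
  convert ((h1.const_smul ν).add (h2.const_smul α)).add (h3.const_smul (-β)) using 2 with u
  rw [ACR, smul_eq_mul, smul_eq_mul, smul_eq_mul]
  ring

lemma ACR_self_ge (hM : M.HasInteriorCells) (hΩ : IsOpen Ω) (hb : Bornology.IsBounded Ω)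
    (hδ : 1 ≤ δ) (hν : 0 ≤ ν) (hβ : 0 ≤ β) (hγ : γ ∈ Ioo (0 : ℝ) 1) (u : M.crSpace) :
    -β * ‖u‖ ^ 2 ≤ M.ACR κ ν α β γ δ u u := by
  have := isFiniteMeasure_restrict_of_bdd hb
  have h1 : 0 ≤ M.aCR u u := by
    rw [aCR_eq]
    exact Finset.sum_nonneg fun T _ => mul_nonneg measureReal_nonneg
      (Finset.sum_nonneg fun i _ => mul_self_nonneg _)
  have h2 : ∫ x in Ω, cFun κ δ γ ((u : L2 Ω) x) * (u : L2 Ω) x ≤ ‖u‖ ^ 2 := by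
    have e : ‖u‖ ^ 2 = ∫ x in Ω, (u : L2 Ω) x * (u : L2 Ω) x := by
      rw [← real_inner_self_eq_norm_sq, Submodule.coe_inner, L2.inner_def]
      simp [← sq]
    rw [e]
    exact integral_mono ((isBallLipschitz_reaction hM hΩ hδ u).integrable u)
      (((isBallLipschitz_coeFn hM hΩ).mul (isBallLipschitz_coeFn hM hΩ)).integrable u)
      fun x => cFun_mul_self_le hγ _
  rw [ACR, bCR_self]
  have := mul_nonneg hν h1
  have := mul_le_mul_of_nonneg_left h2 hβ
  linarith

end Mesh

/-! ### The scheme as an evolution equation in `V_h` -/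

namespace Mesh

variable {d : ℕ} {Ω : Set (Pt d)} {M : Mesh d Ω} {κ ν α β γ δ η T : ℝ}

lemma exists_riesz_ACR (hM : M.HasInteriorCells) (hΩ : IsOpen Ω) (hb : Bornology.IsBounded Ω)
    (hδ : 1 ≤ δ) : ∃ A : M.crSpace → M.crSpace, ∀ u w : M.crSpace,
      inner ℝ (A u) w = M.ACR κ ν α β γ δ u w := by
  have := finiteDimensional_crSpace hM hΩ
  let a : M.crSpace → M.crSpace →ₗ[ℝ] ℝ := fun u =>
    { toFun := fun w => M.ACR κ ν α β γ δ u w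
      map_add' := ACR_add hM hΩ hb hδ u
      map_smul' := ACR_smul hM hΩ u }
  exact ⟨fun u => (InnerProductSpace.toDual ℝ M.crSpace).symm
    (LinearMap.toContinuousLinearMap (a u)), fun u w => InnerProductSpace.toDual_symm_apply⟩

/-- The square root of the volume splits the cell weight evenly between the two factors, so the
memory form becomes `∑ⱼ (K * ⟪eⱼ, u⟫) ⟪eⱼ, χ⟫`, the symmetric shape to which positivity of the
kernel applies. -/
lemma exists_riesz_pderiv (hM : M.HasInteriorCells) (hΩ : IsOpen Ω) :
    ∃ e : M.cells × Fin d → M.crSpace, ∀ j (u : M.crSpace),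
      inner ℝ (e j) u = Real.sqrt (volume.real (cell (j.1 : Finset (Pt d)))) * M.pderiv u j.1 j.2 := by
  have := finiteDimensional_crSpace hM hΩ
  exact ⟨fun j => (InnerProductSpace.toDual ℝ M.crSpace).symm (LinearMap.toContinuousLinearMap
    (Real.sqrt (volume.real (cell (j.1 : Finset (Pt d)))) • pderivₗ hM hΩ j.1 j.2)),
    fun j u => InnerProductSpace.toDual_symm_apply⟩

lemma memory_apply (hM : M.HasInteriorCells) (hΩ : IsOpen Ω) {K : ℝ → ℝ}
    (hK : IntervalIntegrable K volume 0 T) {u : ℝ → M.crSpace} (hu : ContinuousOn u (Icc 0 T))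
    {t : ℝ} (ht : t ∈ Icc 0 T) {S : Finset (Pt d)} (hS : S ∈ M.cells) (i : Fin d) :
    M.memory K (fun τ => (u τ : L2 Ω)) t S i = memConv K (fun τ => M.pderiv (u τ) S i) t := by
  have := finiteDimensional_crSpace hM hΩ
  let G : M.crSpace →L[ℝ] Pt d := LinearMap.toContinuousLinearMap
    ((WithLp.linearEquiv 2 ℝ (Fin d → ℝ)).symm.toLinearMap.comp
      (LinearMap.pi fun i => pderivₗ hM hΩ ⟨S, hS⟩ i))
  have hG : ∀ v : M.crSpace, G v = M.grad v S := fun v => rfl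
  have hi : IntervalIntegrable (fun τ => K (t - τ) • M.grad (u τ) S) volume 0 t := by
    refine (intervalIntegrable_reflect hK ht).smul_continuousOn ?_
    rw [uIcc_of_le ht.1]
    exact G.continuous.comp_continuousOn (hu.mono (Icc_subset_Icc_right ht.2))
  have := (EuclideanSpace.proj (𝕜 := ℝ) i).intervalIntegral_comp_comm hi
  rw [memory, memConv]
  exact this.symm

lemma gradInner_memory (hM : M.HasInteriorCells) (hΩ : IsOpen Ω) {K : ℝ → ℝ}
    (hK : IntervalIntegrable K volume 0 T) {e : M.cells × Fin d → M.crSpace}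
    (he : ∀ j (u : M.crSpace), inner ℝ (e j) u
      = Real.sqrt (volume.real (cell (j.1 : Finset (Pt d)))) * M.pderiv u j.1 j.2)
    {u : ℝ → M.crSpace} (hu : ContinuousOn u (Icc 0 T)) {t : ℝ} (ht : t ∈ Icc 0 T)
    (χ : M.crSpace) :
    M.gradInner (M.memory K (fun τ => (u τ : L2 Ω)) t) (M.grad χ)
      = ∑ j, memConv K (fun τ => inner ℝ (e j) (u τ)) t * inner ℝ (e j) χ := by
  rw [gradInner_eq, Fintype.sum_prod_type, ← Finset.sum_coe_sort]
  refine Finset.sum_congr rfl fun S _ => ?_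
  rw [Finset.mul_sum]
  refine Finset.sum_congr rfl fun i _ => ?_
  rw [memory_apply hM hΩ hK hu ht S.2, he]
  have h1 : memConv K (fun τ => inner ℝ (e (S, i)) (u τ)) t
      = Real.sqrt (volume.real (cell (S : Finset (Pt d))))
        * memConv K (fun τ => M.pderiv (u τ) S i) t := by
    simp only [he, memConv, mul_left_comm (K _), intervalIntegral.integral_const_mul]
  have h2 := Real.mul_self_sqrt
    (measureReal_nonneg (μ := (volume : Measure (Pt d))) (s := cell (S : Finset (Pt d))))
  rw [h1]
  simp only [grad]
  linear_combination (-(memConv K (fun τ => M.pderiv (u τ) S i) t * M.pderiv χ S i)) * h2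

/-! ### Equivalence of the scheme and the integral equation -/

section Equivalence

variable {P : L2 Ω →L[ℝ] M.crSpace}

lemma apply_eq_self_of_mem (hP : ∀ x (χ : M.crSpace), inner ℝ (P x) χ = inner ℝ x (χ : L2 Ω))
    {x : L2 Ω} (hx : x ∈ M.crSpace) : (P x : L2 Ω) = x := by
  have : P x = ⟨x, hx⟩ := ext_inner_right ℝ fun χ => hP x χ
  rw [this]

lemma inner_evolutionRHS
    (hP : ∀ x (χ : M.crSpace), inner ℝ (P x) χ = inner ℝ x (χ : L2 Ω))
    (hM : M.HasInteriorCells) (hΩ : IsOpen Ω) {K : ℝ → ℝ}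
    (hK : IntervalIntegrable K volume 0 T) {e : M.cells × Fin d → M.crSpace}
    (he : ∀ j (u : M.crSpace), inner ℝ (e j) u
      = Real.sqrt (volume.real (cell (j.1 : Finset (Pt d)))) * M.pderiv u j.1 j.2)
    {A : M.crSpace → M.crSpace}
    (hA : ∀ u w : M.crSpace, inner ℝ (A u) w = M.ACR κ ν α β γ δ u w) (f : ℝ → L2 Ω)
    {u : ℝ → M.crSpace} (hu : ContinuousOn u (Icc 0 T)) {t : ℝ} (ht : t ∈ Icc 0 T)
    (χ : M.crSpace) :
    inner ℝ (evolutionRHS A η K e (fun t => P (f t)) u t) χ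
      = inner ℝ (f t) (χ : L2 Ω) - M.ACR κ ν α β γ δ (u t) χ
        - η * M.gradInner (M.memory K (fun τ => (u τ : L2 Ω)) t) (M.grad χ) := by
  rw [CRScheme.inner_evolutionRHS, hA, hP, gradInner_memory hM hΩ hK he hu ht]

/-- By Lebesgue differentiation the primitive has derivative `N t` for almost every `t`; pairing `N
t` with `χ` gives the scheme. -/
lemma isSolution_of_integral_eq
    (hP : ∀ x (χ : M.crSpace), inner ℝ (P x) χ = inner ℝ x (χ : L2 Ω))
    (hM : M.HasInteriorCells) (hΩ : IsOpen Ω) (hT : 0 ≤ T) {K : ℝ → ℝ}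
    (hK : IntervalIntegrable K volume 0 T) {e : M.cells × Fin d → M.crSpace}
    (he : ∀ j (u : M.crSpace), inner ℝ (e j) u
      = Real.sqrt (volume.real (cell (j.1 : Finset (Pt d)))) * M.pderiv u j.1 j.2)
    {A : M.crSpace → M.crSpace}
    (hA : ∀ u w : M.crSpace, inner ℝ (A u) w = M.ACR κ ν α β γ δ u w) {f : ℝ → L2 Ω} {u₀ : L2 Ω}
    {u : ℝ → M.crSpace} (hu : ContinuousOn u (Icc 0 T)) {N : ℝ → M.crSpace}
    (hN : N = evolutionRHS A η K e (fun t => P (f t)) u)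
    (hNi : IntervalIntegrable N volume 0 T) [CompleteSpace M.crSpace]
    (hu' : ∀ t ∈ Icc 0 T, u t = P u₀ + ∫ s in (0 : ℝ)..t, N s) :
    M.IsSolution κ ν α β γ δ η K T f u₀ (fun t => (u t : L2 Ω)) := by
  have hder : ∀ᵐ t ∂(volume.restrict (Ioo 0 T)),
      t ∈ Ioo 0 T ∧ HasDerivAt (fun t => (u t : L2 Ω)) (N t : L2 Ω) t := by
    rw [ae_restrict_iff' measurableSet_Ioo]
    filter_upwards [hNi.ae_hasDerivAt_integral] with t h1 ht
    have ht' : t ∈ uIcc 0 T := by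
      rw [uIcc_of_le hT]
      exact Ioo_subset_Icc_self ht
    have hd : HasDerivAt u (N t) t := by
      refine ((h1 ht' 0 left_mem_uIcc).const_add (P u₀)).congr_of_eventuallyEq ?_
      filter_upwards [Icc_mem_nhds ht.1 ht.2] with s hs using hu' s hs
    exact ⟨ht, M.crSpace.subtypeL.hasFDerivAt.comp_hasDerivAt t hd⟩
  refine ⟨fun t _ => (u t).2, ?_, ?_, ?_, ?_⟩
  · refine (absolutelyContinuousOnInterval_primitive hT hNi).of_dist_le fun x hx y hy => ?_
    rw [uIcc_of_le hT] at hx hy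
    change dist (u x) (u y) ≤ _
    rw [hu' x hx, hu' y hy, dist_add_left]
  · filter_upwards [hder] with t ht using ht.2.differentiableAt
  · filter_upwards [hder] with t ht χ hχ
    have h := inner_evolutionRHS (η := η) hP hM hΩ hK he hA f hu (Ioo_subset_Icc_self ht.1) ⟨χ, hχ⟩
    rw [← hN, Submodule.coe_inner] at h
    rw [ht.2.deriv, h]
    ring
  · intro χ hχ
    have h0 : u 0 = P u₀ := by simpa using hu' 0 (left_mem_Icc.2 hT)
    have := hP u₀ ⟨χ, hχ⟩
    rwa [← h0] at this

/-- A solution takes values in `L²` and lies in `V_h` only for times in `[0, T]`. Composing with `P`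
gives a curve in `V_h` at all times and changes nothing on `[0, T]`. -/
lemma IsSolution.absolutelyContinuousOnInterval_apply
    (hP : ∀ x (χ : M.crSpace), inner ℝ (P x) χ = inner ℝ x (χ : L2 Ω))
    {K : ℝ → ℝ} {f : ℝ → L2 Ω}
    {u₀ : L2 Ω} {u : ℝ → L2 Ω} (hu : M.IsSolution κ ν α β γ δ η K T f u₀ u) (hT : 0 ≤ T) :
    AbsolutelyContinuousOnInterval (fun t => P (u t)) 0 T := by
  refine hu.ac.of_dist_le fun x hx y hy => le_of_eq ?_
  rw [uIcc_of_le hT] at hx hy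
  rw [Subtype.dist_eq, apply_eq_self_of_mem hP (hu.mem x hx), apply_eq_self_of_mem hP (hu.mem y hy)]

lemma IsSolution.integral_eq
    (hP : ∀ x (χ : M.crSpace), inner ℝ (P x) χ = inner ℝ x (χ : L2 Ω))
    (hM : M.HasInteriorCells) (hΩ : IsOpen Ω) (hT : 0 ≤ T) {K : ℝ → ℝ}
    (hK : IntervalIntegrable K volume 0 T) {e : M.cells × Fin d → M.crSpace}
    (he : ∀ j (u : M.crSpace), inner ℝ (e j) u
      = Real.sqrt (volume.real (cell (j.1 : Finset (Pt d)))) * M.pderiv u j.1 j.2)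
    {A : M.crSpace → M.crSpace}
    (hA : ∀ u w : M.crSpace, inner ℝ (A u) w = M.ACR κ ν α β γ δ u w) {f : ℝ → L2 Ω} {u₀ : L2 Ω}
    {u : ℝ → L2 Ω} (hu : M.IsSolution κ ν α β γ δ η K T f u₀ u) {N : ℝ → M.crSpace}
    (hN : N = evolutionRHS A η K e (fun t => P (f t))
      (fun t => P (u t)))
    (hNi : IntervalIntegrable N volume 0 T) [CompleteSpace M.crSpace] :
    ∀ t ∈ Icc 0 T, P (u t)
      = P u₀ + ∫ s in (0 : ℝ)..t, N s := by
  have hac := hu.absolutelyContinuousOnInterval_apply hP hT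
  have hcont := hac.continuousOn
  rw [uIcc_of_le hT] at hcont
  have h0 : P (u 0) = P u₀ :=
    ext_inner_right ℝ fun χ => by
      rw [hP, hP, hu.init χ χ.2]
  rw [← h0]
  refine hac.eq_add_integral hT hNi ?_
  filter_upwards [(ae_restrict_iff' measurableSet_Ioo).1 hu.diff,
    (ae_restrict_iff' measurableSet_Ioo).1 hu.eqn] with t h1 h2 ht
  have ht' := Ioo_subset_Icc_self ht
  have hd := P.hasFDerivAt.comp_hasDerivAt t (h1 ht).hasDerivAt
  have : P (deriv u t) = N t := ext_inner_right ℝ fun χ => by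
    -- The memory at time `t` sees only times in `[0, t]`, where `P` fixes the solution.
    have hmem : M.memory K (fun τ => (P (u τ) : L2 Ω)) t
        = M.memory K u t := by
      funext S
      refine intervalIntegral.integral_congr fun τ hτ => ?_
      rw [uIcc_of_le ht'.1] at hτ
      simp only [apply_eq_self_of_mem hP (hu.mem τ ⟨hτ.1, hτ.2.trans ht'.2⟩)]
    rw [hN, inner_evolutionRHS hP hM hΩ hK he hA f hcont ht' χ, hmem,
      apply_eq_self_of_mem hP (hu.mem t ht'), hP]
    linarith [h2 ht χ χ.2]
  rwa [this] at hd

end Equivalence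

end Mesh

end CRScheme

/-! ### The main theorem -/

theorem mainTheorem5 (d : ℕ) (hd : d = 2 ∨ d = 3)
    (Ω : Set (CRScheme.Pt d)) (hΩ_open : IsOpen Ω) (hΩ_bdd : Bornology.IsBounded Ω)
    (hΩ_conv : Convex ℝ Ω) (hΩ_ne : Ω.Nonempty)
    (M : CRScheme.Mesh d Ω)
    (κ ν α β γ δ η T : ℝ) (hν : 0 < ν) (hα : 0 < α) (hβ : 0 < β) (hγ : γ ∈ Ioo (0 : ℝ) 1)
    (hδ : 1 ≤ δ) (hη : 0 ≤ η) (hT : 0 < T)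
    (K : ℝ → ℝ) (hK : CRScheme.IsPositiveKernel K T)
    (f : ℝ → CRScheme.L2 Ω) (hf : MemLp f 2 (volume.restrict (Ioo 0 T)))
    (u₀ : CRScheme.L2 Ω) :
    (∃ u : ℝ → CRScheme.L2 Ω, M.IsSolution κ ν α β γ δ η K T f u₀ u) ∧
    (MemLp u₀ (ENNReal.ofReal (d * δ)) (volume.restrict Ω) →
      ∀ u v : ℝ → CRScheme.L2 Ω, M.IsSolution κ ν α β γ δ η K T f u₀ u →
        M.IsSolution κ ν α β γ δ η K T f u₀ v → EqOn u v (Icc 0 T)) := by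
  have hM := M.hasInteriorCells hΩ_open hΩ_conv hΩ_ne
  have hfd := CRScheme.Mesh.finiteDimensional_crSpace hM hΩ_open
  have hcomplete : CompleteSpace M.crSpace := FiniteDimensional.complete ℝ _
  have hKi := hK.intervalIntegrable hT.le
  obtain ⟨A, hA⟩ := CRScheme.Mesh.exists_riesz_ACR (κ := κ) (ν := ν) (α := α) (β := β) (γ := γ)
    hM hΩ_open hΩ_bdd hδ
  obtain ⟨e, he⟩ := CRScheme.Mesh.exists_riesz_pderiv hM hΩ_open
  have hAL : CRScheme.LipschitzOnBalls A := CRScheme.LipschitzOnBalls.of_inner fun w => by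
    simp only [hA]
    exact CRScheme.Mesh.lipschitzOnBalls_ACR hM hΩ_open hΩ_bdd hδ w
  have hAC : ∀ u, -β * ‖u‖ ^ 2 ≤ inner ℝ (A u) u := fun u => by
    rw [hA]
    exact CRScheme.Mesh.ACR_self_ge hM hΩ_open hΩ_bdd hδ hν.le hβ.le hγ u
  let P : CRScheme.L2 Ω →L[ℝ] M.crSpace := M.crSpace.orthogonalProjectionOnto
  have hP : ∀ x (χ : M.crSpace), inner ℝ (P x) χ = inner ℝ x (χ : CRScheme.L2 Ω) :=
    fun x χ => Submodule.inner_orthogonalProjectionOnto_eq_of_mem_right χ x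
  clear_value P
  have hg : MemLp (fun t => P (f t)) 2 (volume.restrict (Ioo 0 T)) :=
    P.comp_memLp' hf
  have hgi : IntervalIntegrable (fun t => P (f t)) volume 0 T :=
    (intervalIntegrable_iff_integrableOn_Ioo_of_le hT.le).2 (hg.integrable (by norm_num))
  have hg2 : IntervalIntegrable (fun t => ‖P (f t)‖ ^ 2) volume 0 T :=
    (intervalIntegrable_iff_integrableOn_Ioo_of_le hT.le).2 hg.norm.integrable_sq
  refine ⟨?_, fun _ u v hu hv => ?_⟩
  · obtain ⟨u, hu, hNi, hu'⟩ := CRScheme.evolution_exists hAL hβ.le hAC hη hT.le hK e hgi hg2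
      (P u₀)
    exact ⟨_, CRScheme.Mesh.isSolution_of_integral_eq hP hM hΩ_open hT.le hKi he hA hu rfl hNi hu'⟩
  · have hcont : ∀ w, M.IsSolution κ ν α β γ δ η K T f u₀ w →
        ContinuousOn (fun t => P (w t)) (Icc 0 T) := fun w hw => by
      have := (hw.absolutelyContinuousOnInterval_apply hP hT.le).continuousOn
      rwa [uIcc_of_le hT.le] at this
    have hint : ∀ w, M.IsSolution κ ν α β γ δ η K T f u₀ w → ∀ t ∈ Icc 0 T,
        P (w t) = P u₀ +
          ∫ s in (0 : ℝ)..t, CRScheme.evolutionRHS A η K e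
            (fun t => P (f t))
            (fun t => P (w t)) s := fun w hw =>
      hw.integral_eq hP hM hΩ_open hT.le hKi he hA rfl
        (CRScheme.intervalIntegrable_evolutionRHS hAL.continuous η hT.le hKi e hgi (hcont w hw))
    intro t ht
    -- Uniqueness is known for the projected curves, which agree with the solutions on `[0, T]`.
    rw [← CRScheme.Mesh.apply_eq_self_of_mem hP (hu.mem t ht),
      ← CRScheme.Mesh.apply_eq_self_of_mem hP (hv.mem t ht)]
    exact congrArg _ (CRScheme.evolution_unique hAL hη hT.le hKi e hgi (hcont u hu) (hcont v hv)
      (hint u hu) (hint v hv) ht)
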